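/- Let $k$ be a field of characteristic zero with algebraic closure $\bar k$, and let $k(\alpha)/k$ be a quadratic extension with $\alpha\notin k$, $\alpha^2\in k$; let $\sigma$ be the non-trivial element of $\mathrm{Gal}(k(\alpha)/k)$. Let $e_1,\dots,e_7$ be the standard basis of the 7-dimensional space $W$, let $$\bar w = e_2\wedge e_3\wedge e_4+e_5\wedge e_6\wedge e_7+e_1\wedge(e_2\wedge e_5+e_3\wedge e_6+e_4\wedge e_7)\in\wedge^3W,$$ and let $G\subset \mathrm{GL}(7)$ be the algebraic group over $k$ of all $g$ such that $g\bar w=c(g)\bar w$ for some $c(g)\in \mathrm{GL}(1)$. Let $\Lambda=\mathrm{diag}(1,1,-1)$. For a $k$-algebra $R$ put $R(\alpha)=R\otimes_k k(\alpha)$, let $\sigma$ act on it through the second factor, and for a matrix $A$ over $R(\alpha)$ let ${}^*A={}^tA^\sigma$. Let $\mathrm{SU}_\alpha(2,1)$ be the algebraic group over $k$ with $$\mathrm{SU}_\alpha(2,1)_R=\{A\in \mathrm{SL}(3)_{R(\alpha)} \mid A\Lambda\,{}^*A=\Lambda\}.$$ Let $d(A)=\mathrm{diag}(1,A,{}^tA^{-1})$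 for $A\in\mathrm{SL}(3)$, and let $g_\alpha\in G_{k(\alpha)}$ be $$g_\alpha=\begin{pmatrix} 0&-\alpha&0&0&\alpha&0&0\\ \frac{\alpha^2}{2}&\frac{\alpha^2}{2}&0&0&\frac{\alpha^2}{2}&0&0\\ 0&0&\frac{\alpha}{2}&-\frac{\alpha}{2}&0&-\frac{\alpha}{2}&-\frac{\alpha}{2}\\ 0&0&\frac12&\frac12&0&\frac12&-\frac12\\ -\frac12&\frac12&0&0&\frac12&0&0\\ 0&0&-\frac{\alpha}{2}&-\frac{\alpha}{2}&0&\frac{\alpha}{2}&-\frac{\alpha}{2}\\ 0&0&\frac{\alpha^2}{2}&-\frac{\alpha^2}{2}&0&\frac{\alpha^2}{2}&\frac{\alpha^2}{2}\end{pmatrix}.$$ For $A\in\mathrm{SU}_\alpha(2,1)_R$ the matrix $g_\alpha d(A)g_\alpha^{-1}$, which a priori has entries in $R(\alpha)$, has entries in $R$ and lies in $G_R$, so that $A\mapsto g_\alpha d(A)g_\alpha^{-1}$ is an embedding $\mathrm{SU}_\alpha(2,1)\to G$ of algebraic groups over $k$. For an algebraic group $H$ over $k$, let $H^1(k,H)$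 be the set of equivalence classes of continuous 1-cocycles of $\mathrm{Gal}(\bar k/k)$ with values in the discrete group $H_{\bar k}$, where $h\sim i$ if there is $g\in H_{\bar k}$ with $h_\eta=g^{-1}i_\eta g^\eta$ for all $\eta$. Then the map of sets $H^1(k,\mathrm{SU}_\alpha(2,1))\to H^1(k,G)$ induced by this embedding is injective. -/

import Mathlib

open scoped TensorProduct

namespace NonabelianH1

/-! ### Non-abelian Galois cohomology `H¹(Γ, M)` with continuous cocycles, `M` discrete -/

/-- A continuous 1-cocycle `h : Γ → M` (continuity for the discrete topology on `M` means that `h`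
is locally constant). -/
def IsCocycle {Γ M : Type*} [Group Γ] [TopologicalSpace Γ] [Group M] [MulDistribMulAction Γ M]
    (h : Γ → M) : Prop :=
  IsLocallyConstant h ∧ ∀ a b : Γ, h (a * b) = h a * a • h b

/-- The set of continuous 1-cocycles of `Γ` with values in `M`. -/
abbrev Cocycle (Γ M : Type*) [Group Γ] [TopologicalSpace Γ] [Group M]
    [MulDistribMulAction Γ M] : Type _ :=
  {h : Γ → M // IsCocycle h}

/-- Two cocycles `h`, `i` are equivalent if `h_η = g⁻¹ i_η g^η` for some `g` and all `η`. -/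
instance cocycleSetoid (Γ M : Type*) [Group Γ] [TopologicalSpace Γ] [Group M]
    [MulDistribMulAction Γ M] : Setoid (Cocycle Γ M) where
  r h i := ∃ g : M, ∀ η : Γ, h.1 η = g⁻¹ * i.1 η * η • g
  iseqv :=
    { refl := fun h => ⟨1, fun η => by simp⟩
      symm := by
        rintro h i ⟨g, hg⟩
        exact ⟨g⁻¹, fun η => by rw [hg η]; simp [mul_assoc]⟩
      trans := by
        rintro h i j ⟨g, hg⟩ ⟨g', hg'⟩
        exact ⟨g' * g, fun η => by rw [hg η, hg' η]; simp [mul_assoc]⟩ }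

/-- The pointed set `H¹(Γ, M)`. -/
def H1 (Γ M : Type*) [Group Γ] [TopologicalSpace Γ] [Group M] [MulDistribMulAction Γ M] :
    Type _ :=
  Quotient (cocycleSetoid Γ M)

/-- The map `H¹(Γ, M) → H¹(Γ, N)` induced by an equivariant homomorphism `f : M → N`. -/
def H1.map {Γ M N : Type*} [Group Γ] [TopologicalSpace Γ] [Group M] [MulDistribMulAction Γ M]
    [Group N] [MulDistribMulAction Γ N] (f : M →* N) (hf : ∀ (η : Γ) (m : M), f (η • m) = η • f m) :
    H1 Γ M → H1 Γ N :=
  Quotient.map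
    (fun h => ⟨fun η => f (h.1 η), h.2.1.comp f, fun a b => by
      simp only [h.2.2 a b, map_mul, hf]⟩)
    (by
      rintro h i ⟨g, hg⟩
      exact ⟨f g, fun η => by simp [hg η, hf]⟩)

end NonabelianH1

namespace G2Prehom

/-! ### The group `G ⊂ GL(7)` -/

/-- The coordinate vectors `e_1, …, e_7` of `R⁷` (here numbered `0, …, 6`). -/
def e (R : Type*) [CommRing R] (i : Fin 7) : Fin 7 → R := Pi.single i 1

/-- `e_i ∧ e_j ∧ e_k` in the third exterior power of `R⁷`. -/
noncomputable def wedge (R : Type*) [CommRing R] (i j k : Fin 7) : ⋀[R]^3 (Fin 7 → R) :=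
  exteriorPower.ιMulti R 3 ![e R i, e R j, e R k]

/-- `e_{234} + e_{567} + e_1 ∧ (e_{25} + e_{36} + e_{47})`. -/
noncomputable def wbar (R : Type*) [CommRing R] : ⋀[R]^3 (Fin 7 → R) :=
  wedge R 1 2 3 + wedge R 4 5 6 + (wedge R 0 1 4 + wedge R 0 2 5 + wedge R 0 3 6)

/-- The action of a `7 × 7` matrix on the third exterior power of `R⁷`. -/
noncomputable def act3 {R : Type*} [CommRing R] (g : Matrix (Fin 7) (Fin 7) R) :
    ⋀[R]^3 (Fin 7 → R) →ₗ[R] ⋀[R]^3 (Fin 7 → R) :=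
  exteriorPower.map 3 (Matrix.toLin' g)

lemma act3_one {R : Type*} [CommRing R] : act3 (1 : Matrix (Fin 7) (Fin 7) R) = LinearMap.id := by
  simp [act3]

lemma act3_mul {R : Type*} [CommRing R] (g h : Matrix (Fin 7) (Fin 7) R) :
    act3 (g * h) = act3 g ∘ₗ act3 h := by
  simp [act3, Matrix.toLin'_mul, exteriorPower.map_comp]

/-- The `R`-points of `G = {g ∈ GL(7) | g w̄ = c(g) w̄ for some c(g) ∈ GL(1)}`. -/
noncomputable def G (R : Type*) [CommRing R] : Subgroup (GL (Fin 7) R) where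
  carrier := {g | ∃ c : Rˣ, act3 g.1 (wbar R) = (c : R) • wbar R}
  one_mem' := ⟨1, by simp [act3_one]⟩
  mul_mem' := by
    rintro g h ⟨c, hc⟩ ⟨d, hd⟩
    refine ⟨c * d, ?_⟩
    rw [Units.val_mul, act3_mul, LinearMap.comp_apply, hd, map_smul, hc, smul_smul, Units.val_mul,
      mul_comm]
  inv_mem' := by
    rintro g ⟨c, hc⟩
    refine ⟨c⁻¹, ?_⟩
    have h1 : act3 (g⁻¹).1 (act3 g.1 (wbar R)) = wbar R := by
      rw [← LinearMap.comp_apply, ← act3_mul, ← Units.val_mul, inv_mul_cancel, Units.val_one,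
        act3_one, LinearMap.id_apply]
    rw [hc, map_smul] at h1
    conv_rhs => rw [← h1, smul_smul]
    simp

/-- The `(r₀, r₁, r₂)`-coordinate of `e_i ∧ e_j ∧ e_k` after applying `g`. -/
def minor {R : Type*} [CommRing R] (g : Matrix (Fin 7) (Fin 7) R) (r : Fin 3 → Fin 7)
    (i j k : Fin 7) : R :=
  (g.submatrix r ![i, j, k]).det

/-- The `(r₀, r₁, r₂)`-coordinate of `g w̄`. -/
def coordw {R : Type*} [CommRing R] (g : Matrix (Fin 7) (Fin 7) R) (r : Fin 3 → Fin 7) : R :=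
  minor g r 1 2 3 + minor g r 4 5 6 + (minor g r 0 1 4 + minor g r 0 2 5 + minor g r 0 3 6)

/-- The linear form on the third exterior power with `v₀ ∧ v₁ ∧ v₂ ↦ det (v_j (r_i))`. -/
noncomputable def form {R : Type*} [CommRing R] (r : Fin 3 → Fin 7) :
    Module.Dual R (⋀[R]^3 (Fin 7 → R)) :=
  exteriorPower.pairingDual R (Fin 7 → R) 3
    (exteriorPower.ιMulti R 3 (fun i => (Pi.basisFun R (Fin 7)).coord (r i)))

lemma form_wedge {R : Type*} [CommRing R] (g : Matrix (Fin 7) (Fin 7) R) (r : Fin 3 → Fin 7)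
    (i j k : Fin 7) : form r (act3 g (wedge R i j k)) = minor g r i j k := by
  rw [form, act3, wedge, exteriorPower.map_apply_ιMulti, exteriorPower.pairingDual_ιMulti_ιMulti,
    minor, ← Matrix.det_transpose]
  congr 1
  ext a b
  fin_cases b <;> simp [e, Matrix.mulVec_single]

lemma form_act {R : Type*} [CommRing R] (g : Matrix (Fin 7) (Fin 7) R) (r : Fin 3 → Fin 7) :
    form r (act3 g (wbar R)) = coordw g r := by
  simp only [wbar, map_add, form_wedge, coordw]

lemma form_wbar {R : Type*} [CommRing R] (r : Fin 3 → Fin 7) :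
    form r (wbar R) = coordw 1 r := by
  rw [← form_act, act3_one, LinearMap.id_apply]

lemma ext_form {R : Type*} [CommRing R] (x y : ⋀[R]^3 (Fin 7 → R))
    (h : ∀ r : Fin 3 → Fin 7, StrictMono r → form r x = form r y) : x = y := by
  refine ((Pi.basisFun R (Fin 7)).exteriorPower 3).ext_elem fun s => ?_
  rw [exteriorPower.basis_repr_apply, exteriorPower.basis_repr_apply]
  exact h _ (Set.powersetCard.ofFinEmbEquiv.symm s).strictMono

lemma coordw_one_123 {R : Type*} [CommRing R] :
    coordw (1 : Matrix (Fin 7) (Fin 7) R) ![1, 2, 3] = 1 := by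
  simp only [coordw, minor, Matrix.det_fin_three, Matrix.submatrix_apply]
  simp [Matrix.one_apply]

lemma act_iff {R : Type*} [CommRing R] (g : Matrix (Fin 7) (Fin 7) R) (c : R) :
    act3 g (wbar R) = c • wbar R ↔ ∀ r, StrictMono r → coordw g r = c * coordw 1 r := by
  constructor
  · intro h r _
    rw [← form_act, h, map_smul, form_wbar, smul_eq_mul]
  · intro h
    refine ext_form _ _ fun r hr => ?_
    rw [form_act, map_smul, form_wbar, smul_eq_mul, h r hr]

lemma coordw_map {R S : Type*} [CommRing R] [CommRing S] (f : R →+* S)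
    (g : Matrix (Fin 7) (Fin 7) R) (r : Fin 3 → Fin 7) :
    coordw (g.map f) r = f (coordw g r) := by
  simp [coordw, minor, Matrix.submatrix_map, RingHom.map_det, RingHom.mapMatrix_apply]

lemma coordw_one_map {R S : Type*} [CommRing R] [CommRing S] (f : R →+* S)
    (r : Fin 3 → Fin 7) : coordw (1 : Matrix (Fin 7) (Fin 7) S) r = f (coordw 1 r) := by
  rw [← coordw_map]
  simp

/-- The map `G(R) → G(S)` induced by a ring homomorphism `R → S` (entrywise). -/
noncomputable def G.map {R S : Type*} [CommRing R] [CommRing S] (f : R →+* S) : G R →* G S :=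
  ((Matrix.GeneralLinearGroup.map f).comp (G R).subtype).codRestrict (G S) (by
    rintro ⟨g, c, hc⟩
    refine ⟨Units.map f c, (act_iff _ _).2 fun r hr => ?_⟩
    have := (act_iff _ _).1 hc r hr
    change coordw (g.1.map f) r = f c * _
    rw [coordw_map, this, map_mul, ← coordw_one_map])

@[simp] lemma G.map_apply {R S : Type*} [CommRing R] [CommRing S] (f : R →+* S) (g : G R)
    (i j : Fin 7) : (G.map f g).1.1 i j = f (g.1.1 i j) := rfl

lemma G.ext' {R : Type*} [CommRing R] {g h : G R} (H : ∀ i j, g.1.1 i j = h.1.1 i j) : g = h :=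
  Subtype.ext (Units.ext (Matrix.ext H))

/-- `Gal(L/k)` acts on `G(L)` entrywise. -/
noncomputable instance G.galAction (k L : Type*) [Field k] [Field L] [Algebra k L] :
    MulDistribMulAction (L ≃ₐ[k] L) (G L) where
  smul η g := G.map (η : L →+* L) g
  one_smul _ := G.ext' fun _ _ => rfl
  mul_smul _ _ _ := G.ext' fun _ _ => rfl
  smul_mul η g h := map_mul (G.map (η : L →+* L)) g h
  smul_one η := map_one (G.map (η : L →+* L))

/-! ### The unitary group `SU_α(2,1)` -/

/-- `Λ = diag(1, 1, -1)`. -/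
def Lam (T : Type*) [CommRing T] : Matrix (Fin 3) (Fin 3) T := Matrix.diagonal ![1, 1, -1]

section SU

variable {k K : Type*} [Field k] [Field K] [Algebra k K]

/-- The action `r ⊗ x ↦ r ⊗ x^σ` of `σ` on `R ⊗ K`. -/
noncomputable def conj (σ : K ≃ₐ[k] K) (R : Type*) [CommRing R] [Algebra k R] :
    R ⊗[k] K →ₐ[R] R ⊗[k] K :=
  Algebra.TensorProduct.map (AlgHom.id R R) (σ : K →ₐ[k] K)

/-- `*A`, the transpose of `A^σ`. -/
noncomputable def conjTr (σ : K ≃ₐ[k] K) (R : Type*) [CommRing R] [Algebra k R]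
    (A : Matrix (Fin 3) (Fin 3) (R ⊗[k] K)) : Matrix (Fin 3) (Fin 3) (R ⊗[k] K) :=
  (A.map (conj σ R)).transpose

lemma conjTr_mul (σ : K ≃ₐ[k] K) (R : Type*) [CommRing R] [Algebra k R]
    (A B : Matrix (Fin 3) (Fin 3) (R ⊗[k] K)) : conjTr σ R (A * B) = conjTr σ R B * conjTr σ R A := by
  simp [conjTr, Matrix.map_mul]

lemma conjTr_one (σ : K ≃ₐ[k] K) (R : Type*) [CommRing R] [Algebra k R] :
    conjTr σ R 1 = 1 := by
  simp [conjTr]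

/-- The `R`-points of the special unitary group of `Λ`, i.e. the matrices `A ∈ SL(3)_{R ⊗ K}`
with `A Λ *A = Λ`. -/
noncomputable def SU (σ : K ≃ₐ[k] K) (R : Type*) [CommRing R] [Algebra k R] :
    Subgroup (Matrix.SpecialLinearGroup (Fin 3) (R ⊗[k] K)) where
  carrier := {A | A.1 * Lam (R ⊗[k] K) * conjTr σ R A.1 = Lam (R ⊗[k] K)}
  one_mem' := by simp [conjTr_one]
  mul_mem' := by
    intro A B hA hB
    simp only [Set.mem_ofPred_eq] at hA hB ⊢
    rw [Matrix.SpecialLinearGroup.coe_mul, conjTr_mul]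
    calc A.1 * B.1 * Lam _ * (conjTr σ R B.1 * conjTr σ R A.1)
        = A.1 * (B.1 * Lam _ * conjTr σ R B.1) * conjTr σ R A.1 := by simp only [mul_assoc]
      _ = _ := by rw [hB, hA]
  inv_mem' := by
    intro A hA
    simp only [Set.mem_ofPred_eq] at hA ⊢
    have h1 : (A⁻¹).1 * A.1 = 1 := by
      rw [← Matrix.SpecialLinearGroup.coe_mul, inv_mul_cancel, Matrix.SpecialLinearGroup.coe_one]
    have h2 : conjTr σ R A.1 * conjTr σ R (A⁻¹).1 = 1 := by rw [← conjTr_mul, h1, conjTr_one]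
    calc (A⁻¹).1 * Lam _ * conjTr σ R (A⁻¹).1
        = (A⁻¹).1 * (A.1 * Lam _ * conjTr σ R A.1) * conjTr σ R (A⁻¹).1 := by rw [hA]
      _ = ((A⁻¹).1 * A.1) * Lam _ * (conjTr σ R A.1 * conjTr σ R (A⁻¹).1) := by
          simp only [mul_assoc]
      _ = _ := by rw [h1, h2]; simp

/-- The map `R ⊗ K → S ⊗ K` induced by a homomorphism of `k`-algebras `R → S`. -/
noncomputable def baseMap {R S : Type*} [CommRing R] [Algebra k R] [CommRing S] [Algebra k S]
    (f : R →ₐ[k] S) : R ⊗[k] K →ₐ[k] S ⊗[k] K :=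
  Algebra.TensorProduct.map f (AlgHom.id k K)

lemma baseMap_comp {R S T : Type*} [CommRing R] [Algebra k R] [CommRing S] [Algebra k S]
    [CommRing T] [Algebra k T] (f : S →ₐ[k] T) (g : R →ₐ[k] S) (x : R ⊗[k] K) :
    baseMap (f.comp g) x = baseMap f (baseMap g x) := by
  induction x with
  | zero => simp
  | tmul r x => simp [baseMap]
  | add x y hx hy => simp only [map_add, hx, hy]

lemma baseMap_conj (σ : K ≃ₐ[k] K) {R S : Type*} [CommRing R] [Algebra k R] [CommRing S]
    [Algebra k S] (f : R →ₐ[k] S) (x : R ⊗[k] K) :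
    baseMap f (conj σ R x) = conj σ S (baseMap f x) := by
  induction x with
  | zero => simp
  | tmul r x => simp [baseMap, conj]
  | add x y hx hy => simp [hx, hy]

lemma Lam_map {T U : Type*} [CommRing T] [CommRing U] (f : T →+* U) :
    (Lam T).map f = Lam U := by
  ext i j
  fin_cases i <;> fin_cases j <;> simp [Lam]

/-- The map `SU(R) → SU(S)` induced by a homomorphism of `k`-algebras `R → S`. -/
noncomputable def SU.map (σ : K ≃ₐ[k] K) {R S : Type*} [CommRing R] [Algebra k R] [CommRing S]
    [Algebra k S] (f : R →ₐ[k] S) : SU σ R →* SU σ S :=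
  ((Matrix.SpecialLinearGroup.map ((baseMap f : R ⊗[k] K →ₐ[k] S ⊗[k] K) :
    R ⊗[k] K →+* S ⊗[k] K)).comp (SU σ R).subtype).codRestrict (SU σ S) (by
    rintro ⟨A, hA⟩
    have h := congrArg
      (fun M => M.map ((baseMap f : R ⊗[k] K →ₐ[k] S ⊗[k] K) : R ⊗[k] K →+* S ⊗[k] K)) hA
    simp only [Matrix.map_mul, Lam_map] at h
    change A.1.map ((baseMap f : R ⊗[k] K →ₐ[k] S ⊗[k] K) : R ⊗[k] K →+* S ⊗[k] K) *
      Lam _ * conjTr σ S (A.1.map _) = Lam _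
    rw [← h]
    congr 1
    · rw [h]
    · ext i j
      exact (baseMap_conj σ f _).symm)

@[simp] lemma SU.map_apply (σ : K ≃ₐ[k] K) {R S : Type*} [CommRing R] [Algebra k R] [CommRing S]
    [Algebra k S] (f : R →ₐ[k] S) (A : SU σ R) (i j : Fin 3) :
    (SU.map σ f A).1.1 i j = baseMap f (A.1.1 i j) := rfl

lemma SU.ext' {σ : K ≃ₐ[k] K} {R : Type*} [CommRing R] [Algebra k R] {A B : SU σ R}
    (H : ∀ i j, A.1.1 i j = B.1.1 i j) : A = B :=
  Subtype.ext (Subtype.ext (Matrix.ext H))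

/-- `Gal(L/k)` acts on `SU(L)` through the factor `L` of `L ⊗ K`. -/
noncomputable instance SU.galAction (σ : K ≃ₐ[k] K) (L : Type*) [Field L] [Algebra k L] :
    MulDistribMulAction (L ≃ₐ[k] L) (SU σ L) where
  smul η A := SU.map σ (η : L →ₐ[k] L) A
  one_smul A := SU.ext' fun i j => by
    change baseMap (AlgHom.id k L) _ = _
    simp [baseMap]
  mul_smul a b A := SU.ext' fun i j => by
    change baseMap ((a : L →ₐ[k] L).comp (b : L →ₐ[k] L)) (A.1.1 i j) =
      baseMap (a : L →ₐ[k] L) (baseMap (b : L →ₐ[k] L) (A.1.1 i j))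
    exact baseMap_comp (a : L →ₐ[k] L) (b : L →ₐ[k] L) (A.1.1 i j)
  smul_mul η A B := map_mul (SU.map σ (η : L →ₐ[k] L)) A B
  smul_one η := map_one (SU.map σ (η : L →ₐ[k] L))

end SU

/-! ### The natural map `SU_α(2,1) → G` -/

/-- The decomposition of the index set `{1, …, 7}` as `{1} ∪ {2, 3, 4} ∪ {5, 6, 7}`. -/
def idx : Fin 7 ≃ Fin 1 ⊕ (Fin 3 ⊕ Fin 3) :=
  (finSumFinEquiv (m := 1) (n := 6)).symm.trans
    (Equiv.sumCongr (Equiv.refl (Fin 1)) (finSumFinEquiv (m := 3) (n := 3)).symm)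

/-- The matrix with blocks `1, A₁, A₂, A₃, A₄` (where `A₁, …, A₄` are `3 × 3`). -/
def block {T : Type*} [CommRing T] (A₁ A₂ A₃ A₄ : Matrix (Fin 3) (Fin 3) T) :
    Matrix (Fin 7) (Fin 7) T :=
  (Matrix.fromBlocks 1 0 0 (Matrix.fromBlocks A₁ A₂ A₃ A₄)).submatrix idx idx

lemma block_mul {T : Type*} [CommRing T] (A₁ A₂ A₃ A₄ B₁ B₂ B₃ B₄ : Matrix (Fin 3) (Fin 3) T) :
    block A₁ A₂ A₃ A₄ * block B₁ B₂ B₃ B₄ =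
      block (A₁ * B₁ + A₂ * B₃) (A₁ * B₂ + A₂ * B₄) (A₃ * B₁ + A₄ * B₃) (A₃ * B₂ + A₄ * B₄) := by
  rw [block, block, Matrix.submatrix_mul_equiv, Matrix.fromBlocks_multiply,
    Matrix.fromBlocks_multiply]
  simp [block]

lemma block_one {T : Type*} [CommRing T] : block (1 : Matrix (Fin 3) (Fin 3) T) 0 0 1 = 1 := by
  simp [block, Matrix.fromBlocks_one]

/-- The matrix `diag(1, A, B)` with `3 × 3` blocks `A`, `B`. -/
def blk {T : Type*} [CommRing T] (A B : Matrix (Fin 3) (Fin 3) T) : Matrix (Fin 7) (Fin 7) T :=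
  block A 0 0 B

lemma blk_eq {T : Type*} [CommRing T] (A B : Matrix (Fin 3) (Fin 3) T) : blk A B =
    !![1, 0, 0, 0, 0, 0, 0;
      0, A 0 0, A 0 1, A 0 2, 0, 0, 0;
      0, A 1 0, A 1 1, A 1 2, 0, 0, 0;
      0, A 2 0, A 2 1, A 2 2, 0, 0, 0;
      0, 0, 0, 0, B 0 0, B 0 1, B 0 2;
      0, 0, 0, 0, B 1 0, B 1 1, B 1 2;
      0, 0, 0, 0, B 2 0, B 2 1, B 2 2] := by
  ext i j
  fin_cases i <;> fin_cases j <;> rfl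

lemma blk_mul {T : Type*} [CommRing T] (A B A' B' : Matrix (Fin 3) (Fin 3) T) :
    blk A B * blk A' B' = blk (A * A') (B * B') := by
  simp [blk, block_mul]

lemma blk_one {T : Type*} [CommRing T] : blk (1 : Matrix (Fin 3) (Fin 3) T) 1 = 1 := block_one

lemma blk_map {T U : Type*} [CommRing T] [CommRing U] (f : T →+* U)
    (A B : Matrix (Fin 3) (Fin 3) T) : (blk A B).map f = blk (A.map f) (B.map f) := by
  ext i j
  simp only [blk, block, Matrix.map_apply, Matrix.submatrix_apply]
  rcases idx i with a | a | a <;> rcases idx j with b | b | b <;> simp [Matrix.one_apply]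

/-- `d(A) = diag(1, A, ᵗA⁻¹)` as an element of `GL(7)`. -/
noncomputable def dGL (T : Type*) [CommRing T] :
    Matrix.SpecialLinearGroup (Fin 3) T →* GL (Fin 7) T :=
  MonoidHom.toHomUnits
    { toFun := fun A => blk A.1 (A⁻¹).1.transpose
      map_one' := by simp [blk_one]
      map_mul' := fun A B => by
        rw [blk_mul, mul_inv_rev, Matrix.SpecialLinearGroup.coe_mul,
          Matrix.SpecialLinearGroup.coe_mul, Matrix.transpose_mul] }

lemma dGL_coe {T : Type*} [CommRing T] (A : Matrix.SpecialLinearGroup (Fin 3) T) :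
    (dGL T A).1 = blk A.1 (A⁻¹).1.transpose := rfl

lemma coordw_eq {T : Type*} [CommRing T] (M : Matrix (Fin 7) (Fin 7) T) (r : Fin 3 → Fin 7) :
    coordw M r = coordw M ![r 0, r 1, r 2] := by
  congr 1
  ext a
  fin_cases a <;> rfl


/-- The coefficient of `e_i ∧ e_j ∧ e_k` (`i < j < k`) in `w̄`. -/
def wcoef (i j k : Fin 7) : ℕ :=
  if (i, j, k) ∈ [((1 : Fin 7), (2 : Fin 7), (3 : Fin 7)), (4, 5, 6), (0, 1, 4), (0, 2, 5),
    (0, 3, 6)] then 1 else 0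

/-- `coordw` written out. -/
lemma coordw_expand {T : Type*} [CommRing T] (M : Matrix (Fin 7) (Fin 7) T) (i j k : Fin 7) :
    coordw M ![i, j, k] =
      (let m (a b c : Fin 7) : T := M i a * (M j b * M k c - M j c * M k b) -
        M i b * (M j a * M k c - M j c * M k a) + M i c * (M j a * M k b - M j b * M k a)
      m 1 2 3 + m 4 5 6 + (m 0 1 4 + m 0 2 5 + m 0 3 6)) := by
  simp only [coordw, minor, Matrix.det_fin_three, Matrix.submatrix_apply]
  simp only [Matrix.cons_val]
  ring

lemma coordw_one_int : ∀ i j k : Fin 7, i < j → j < k →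
    coordw (1 : Matrix (Fin 7) (Fin 7) ℤ) ![i, j, k] = wcoef i j k := by
  simp only [coordw_expand]
  decide

lemma coordw_one {T : Type*} [CommRing T] (i j k : Fin 7) (hij : i < j) (hjk : j < k) :
    coordw (1 : Matrix (Fin 7) (Fin 7) T) ![i, j, k] = wcoef i j k := by
  rw [coordw_one_map (Int.castRingHom T), coordw_one_int i j k hij hjk]
  simp

/-- A criterion for membership in `G`: it suffices to compare the coordinates with `i < j < k`. -/
lemma act_of {T : Type*} [CommRing T] (M : Matrix (Fin 7) (Fin 7) T) (c : T)
    (h : ∀ i j k : Fin 7, i < j → j < k → coordw M ![i, j, k] = c * wcoef i j k) :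
    act3 M (wbar T) = c • wbar T := by
  refine (act_iff _ _).2 fun r hr => ?_
  have h01 : r 0 < r 1 := hr (by decide)
  have h12 : r 1 < r 2 := hr (by decide)
  rw [coordw_eq, coordw_eq 1, h _ _ _ h01 h12, coordw_one _ _ _ h01 h12]

set_option maxHeartbeats 4000000 in
lemma blk_act {T : Type*} [CommRing T] (A B : Matrix (Fin 3) (Fin 3) T) (hA : A.det = 1)
    (hB : B.det = 1) (hAB : A * B.transpose = 1) :
    act3 (blk A B) (wbar T) = (1 : T) • wbar T := by
  refine act_of _ _ fun i j k hij hjk => ?_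
  rw [Matrix.det_fin_three] at hA hB
  have h (a b : Fin 3) := congrFun (congrFun hAB a) b
  simp only [Matrix.mul_apply, Fin.sum_univ_three, Matrix.transpose_apply] at h
  have h00 := h 0 0
  have h01 := h 0 1
  have h02 := h 0 2
  have h10 := h 1 0
  have h11 := h 1 1
  have h12 := h 1 2
  have h20 := h 2 0
  have h21 := h 2 1
  have h22 := h 2 2
  clear h hAB
  simp at h00 h01 h02 h10 h11 h12 h20 h21 h22
  rw [coordw_expand]
  dsimp only
  fin_cases i <;> fin_cases j <;> first
    | (exfalso; revert hij; decide)
    | (fin_cases k <;> first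
        | (exfalso; revert hjk; decide)
        | (simp [blk_eq, wcoef] <;> grind))

lemma dGL_mem {T : Type*} [CommRing T] (A : Matrix.SpecialLinearGroup (Fin 3) T) :
    dGL T A ∈ G T := by
  refine ⟨1, ?_⟩
  rw [dGL_coe, Units.val_one]
  refine blk_act _ _ A.2 ?_ ?_
  · rw [Matrix.det_transpose]
    exact (A⁻¹).2
  · rw [Matrix.transpose_transpose, ← Matrix.SpecialLinearGroup.coe_mul, mul_inv_cancel,
      Matrix.SpecialLinearGroup.coe_one]

/-- The embedding `d : SL(3) → G`, `A ↦ diag(1, A, ᵗA⁻¹)`. -/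
noncomputable def d (T : Type*) [CommRing T] : Matrix.SpecialLinearGroup (Fin 3) T →* G T :=
  (dGL T).codRestrict (G T) dGL_mem

/-- The matrix `g_α`. -/
def gMat {K : Type*} [Field K] (α : K) : Matrix (Fin 7) (Fin 7) K :=
  !![0, -α, 0, 0, α, 0, 0;
     α ^ 2 / 2, α ^ 2 / 2, 0, 0, α ^ 2 / 2, 0, 0;
     0, 0, α / 2, -α / 2, 0, -α / 2, -α / 2;
     0, 0, 1 / 2, 1 / 2, 0, 1 / 2, -1 / 2;
     -1 / 2, 1 / 2, 0, 0, 1 / 2, 0, 0;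
     0, 0, -α / 2, -α / 2, 0, α / 2, -α / 2;
     0, 0, α ^ 2 / 2, -α ^ 2 / 2, 0, α ^ 2 / 2, α ^ 2 / 2]

/-- The inverse of `g_α`. -/
def gInv {K : Type*} [Field K] (α : K) : Matrix (Fin 7) (Fin 7) K :=
  !![0, 1 / α ^ 2, 0, 0, -1, 0, 0;
     -1 / (2 * α), 1 / (2 * α ^ 2), 0, 0, 1 / 2, 0, 0;
     0, 0, 1 / (2 * α), 1 / 2, 0, -1 / (2 * α), 1 / (2 * α ^ 2);
     0, 0, -1 / (2 * α), 1 / 2, 0, -1 / (2 * α), -1 / (2 * α ^ 2);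
     1 / (2 * α), 1 / (2 * α ^ 2), 0, 0, 1 / 2, 0, 0;
     0, 0, -1 / (2 * α), 1 / 2, 0, 1 / (2 * α), 1 / (2 * α ^ 2);
     0, 0, -1 / (2 * α), -1 / 2, 0, -1 / (2 * α), 1 / (2 * α ^ 2)]

set_option maxHeartbeats 4000000 in
lemma gMat_mul_gInv {K : Type*} [Field K] (h2 : (2 : K) ≠ 0) {α : K} (hα : α ≠ 0) :
    gMat α * gInv α = 1 := by
  ext i j
  fin_cases i <;> fin_cases j <;>
    simp [gMat, gInv, Matrix.mul_apply, Fin.sum_univ_seven] <;> field_simp <;> ring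

set_option maxHeartbeats 4000000 in
lemma gMat_act {K : Type*} [Field K] (h2 : (2 : K) ≠ 0) (α : K) :
    act3 (gMat α) (wbar K) = (α ^ 3) • wbar K := by
  refine act_of _ _ fun i j k hij hjk => ?_
  rw [coordw_expand]
  dsimp only
  fin_cases i <;> fin_cases j <;> first
    | (exfalso; revert hij; decide)
    | (fin_cases k <;> first
        | (exfalso; revert hjk; decide)
        | (simp [gMat, wcoef] <;> field_simp <;> first | ring1 | (ring_nf; simp)))

/-- `g_α` as an element of `G(K)`. -/
noncomputable def gAlpha {K : Type*} [Field K] (h2 : (2 : K) ≠ 0) {α : K} (hα : α ≠ 0) : G K :=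
  ⟨⟨gMat α, gInv α, gMat_mul_gInv h2 hα, mul_eq_one_comm.1 (gMat_mul_gInv h2 hα)⟩,
    Units.mk0 (α ^ 3) (pow_ne_zero 3 hα), gMat_act h2 α⟩

/-- The matrix `τ` with blocks `1` and `0, Λ, Λ, 0`. -/
def tau (T : Type*) [CommRing T] : Matrix (Fin 7) (Fin 7) T := block 0 (Lam T) (Lam T) 0

lemma tau_eq (T : Type*) [CommRing T] : tau T =
    !![1, 0, 0, 0, 0, 0, 0;
      0, 0, 0, 0, 1, 0, 0;
      0, 0, 0, 0, 0, 1, 0;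
      0, 0, 0, 0, 0, 0, -1;
      0, 1, 0, 0, 0, 0, 0;
      0, 0, 1, 0, 0, 0, 0;
      0, 0, 0, -1, 0, 0, 0] := by
  ext i j
  fin_cases i <;> fin_cases j <;> rfl

lemma gMat_neg {K : Type*} [Field K] (α : K) : gMat (-α) = gMat α * tau K := by
  rw [tau_eq]
  ext i j
  fin_cases i <;> fin_cases j <;>
    simp [gMat, Matrix.mul_apply, Fin.sum_univ_seven, neg_div]

lemma Lam_mul_Lam (T : Type*) [CommRing T] : Lam T * Lam T = 1 := by
  ext i j
  fin_cases i <;> fin_cases j <;> simp [Lam]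

lemma Lam_transpose (T : Type*) [CommRing T] : (Lam T).transpose = Lam T := by
  simp [Lam]

lemma tau_mul_blk {T : Type*} [CommRing T] (A B : Matrix (Fin 3) (Fin 3) T) :
    tau T * blk (Lam T * A * Lam T) (Lam T * B * Lam T) = blk B A * tau T := by
  have h (X : Matrix (Fin 3) (Fin 3) T) : Lam T * (Lam T * X * Lam T) = X * Lam T := by
    rw [mul_assoc, ← mul_assoc, Lam_mul_Lam, one_mul]
  simp only [tau, blk, block_mul, h]
  simp

lemma tau_map {T U : Type*} [CommRing T] [CommRing U] (f : T →+* U) :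
    (tau T).map f = tau U := by
  rw [tau, tau, ← Lam_map f]
  ext i j
  simp only [block, Matrix.map_apply, Matrix.submatrix_apply]
  rcases idx i with a | a | a <;> rcases idx j with b | b | b <;> simp [Matrix.one_apply]

lemma gMat_map {K T : Type*} [Field K] [Field T] (f : K →+* T) (α : K) :
    (gMat α).map f = gMat (f α) := by
  ext i j
  fin_cases i <;> fin_cases j <;> simp [gMat, map_ofNat]

section Embed

variable {k K : Type*} [Field k] [Field K] [Algebra k K]

lemma two_ne (k K : Type*) [Field k] [CharZero k] [Field K] [Algebra k K] : (2 : K) ≠ 0 := by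
  have h : algebraMap k K 2 ≠ 0 := by
    rw [Ne, map_eq_zero]
    exact two_ne_zero
  rwa [map_ofNat] at h

lemma ne_zero_of_notMem {α : K} (hα : α ∉ Set.range (algebraMap k K)) : α ≠ 0 := by
  rintro rfl
  exact hα ⟨0, map_zero _⟩

/-- The basis `1, α` of `K = k(α)` over `k`. -/
noncomputable def basisK (hK : Module.finrank k K = 2) {α : K}
    (hα : α ∉ Set.range (algebraMap k K)) : Module.Basis (Fin 2) k K :=
  basisOfLinearIndependentOfCardEqFinrank (b := ![1, α])
    (by
      rw [LinearIndependent.pair_iff]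
      intro s t h
      have ht : t = 0 := by
        by_contra ht
        refine hα ⟨-s / t, ?_⟩
        have ht' : algebraMap k K t ≠ 0 := by rwa [Ne, map_eq_zero]
        rw [Algebra.smul_def, Algebra.smul_def, mul_one] at h
        rw [map_div₀, map_neg, div_eq_iff ht']
        linear_combination -h
      subst ht
      simpa using h)
    (by simp [hK])

lemma basisK_apply (hK : Module.finrank k K = 2) {α : K}
    (hα : α ∉ Set.range (algebraMap k K)) : ⇑(basisK hK hα) = ![1, α] := by
  simp [basisK]

lemma exists_decomp (hK : Module.finrank k K = 2) {α : K}
    (hα : α ∉ Set.range (algebraMap k K)) (x : K) :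
    ∃ a b : k, x = algebraMap k K a + algebraMap k K b * α := by
  refine ⟨(basisK hK hα).repr x 0, (basisK hK hα).repr x 1, ?_⟩
  conv_lhs => rw [← (basisK hK hα).sum_repr x]
  simp [Fin.sum_univ_two, basisK_apply, Algebra.smul_def]

/-- The non-trivial element of `Gal(k(α)/k)` maps `α` to `-α`. -/
lemma sigma_alpha (hK : Module.finrank k K = 2) {α : K}
    (hα : α ∉ Set.range (algebraMap k K)) (hα2 : α ^ 2 ∈ Set.range (algebraMap k K))
    {σ : K ≃ₐ[k] K} (hσ : σ ≠ 1) : σ α = -α := by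
  obtain ⟨a, ha⟩ := hα2
  have h : σ α ^ 2 = α ^ 2 := by rw [← map_pow, ← ha, AlgEquiv.commutes]
  rcases sq_eq_sq_iff_eq_or_eq_neg.1 h with h | h
  · refine absurd (AlgEquiv.ext fun x => ?_) hσ
    obtain ⟨a, b, rfl⟩ := exists_decomp hK hα x
    simp [h]
  · exact h

/-- The elements of `R ⊗ K` fixed by `σ` are those of `R`. -/
lemma conj_fixed [CharZero k] (hK : Module.finrank k K = 2) {α : K}
    (hα : α ∉ Set.range (algebraMap k K)) (hα2 : α ^ 2 ∈ Set.range (algebraMap k K))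
    {σ : K ≃ₐ[k] K} (hσ : σ ≠ 1) (R : Type*) [CommRing R] [Algebra k R] (x : R ⊗[k] K)
    (hx : conj σ R x = x) : ∃ r : R, r ⊗ₜ[k] (1 : K) = x := by
  let b := (basisK hK hα).baseChange R
  have hb0 : b 0 = 1 ⊗ₜ[k] (1 : K) := by simp [b, basisK_apply]
  have hb1 : b 1 = 1 ⊗ₜ[k] α := by simp [b, basisK_apply]
  have hsum : b.repr x 0 • b 0 + b.repr x 1 • b 1 = x := by
    rw [← Fin.sum_univ_two (fun i => b.repr x i • b i), b.sum_repr]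
  have hc : b.repr x 0 • b 0 - b.repr x 1 • b 1 = x := by
    conv_rhs => rw [← hx, ← hsum]
    rw [map_add, map_smul, map_smul, hb0, hb1]
    simp [conj, sigma_alpha hK hα hα2 hσ, TensorProduct.tmul_neg, sub_eq_add_neg]
  have h1 : b.repr x 1 = 0 := by
    have h := congrArg (fun y => b.repr y 1) (hsum.trans hc.symm)
    simp only [map_add, map_sub, map_smul, Finsupp.add_apply, Finsupp.sub_apply,
      Finsupp.smul_apply, b.repr_self, smul_eq_mul] at h
    simp at h
    have h2 : (2 : k) • b.repr x 1 = 0 := by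
      rw [two_smul]
      linear_combination h
    have := congrArg (fun y => (2 : k)⁻¹ • y) h2
    simpa [smul_smul] using this
  refine ⟨b.repr x 0, ?_⟩
  conv_rhs => rw [← hsum, h1, hb0]
  simp [TensorProduct.smul_tmul']

/-- The inclusion `R → R ⊗ K`, `r ↦ r ⊗ 1`. -/
noncomputable def incL (k K R : Type*) [Field k] [Field K] [Algebra k K] [CommRing R]
    [Algebra k R] : R →+* R ⊗[k] K :=
  Algebra.TensorProduct.includeLeftRingHom

/-- The inclusion `K → R ⊗ K`, `x ↦ 1 ⊗ x`. -/
noncomputable def incR (k K R : Type*) [Field k] [Field K] [Algebra k K] [CommRing R]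
    [Algebra k R] : K →+* R ⊗[k] K :=
  ((Algebra.TensorProduct.includeRight : K →ₐ[k] R ⊗[k] K) : K →+* R ⊗[k] K)

lemma incL_injective (k K R : Type*) [Field k] [Field K] [Algebra k K] [CommRing R]
    [Algebra k R] : Function.Injective (incL k K R) :=
  Algebra.TensorProduct.includeLeft_injective (S := k) (algebraMap k K).injective

lemma G.map_injective {R S : Type*} [CommRing R] [CommRing S] {f : R →+* S}
    (hf : Function.Injective f) : Function.Injective (G.map f) := fun g h H =>
  G.ext' fun i j => hf (by rw [← G.map_apply, ← G.map_apply, H])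

lemma mem_of_act {R : Type*} [CommRing R] (g : GL (Fin 7) R) (c : R)
    (h : act3 g.1 (wbar R) = c • wbar R) : g ∈ G R := by
  have h1 : act3 (g⁻¹).1 (act3 g.1 (wbar R)) = wbar R := by
    rw [← LinearMap.comp_apply, ← act3_mul, ← Units.val_mul, inv_mul_cancel, Units.val_one,
      act3_one, LinearMap.id_apply]
  rw [h, map_smul] at h1
  have h2 := congrArg (form ![1, 2, 3]) h1
  rw [map_smul, form_act, form_wbar, coordw_one_123, smul_eq_mul] at h2
  exact ⟨Units.mkOfMulEqOne _ _ h2, h⟩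

/-- Galois descent for `G`: the elements of `G(R ⊗ K)` fixed by `σ` come from `G(R)`. -/
lemma G.descent [CharZero k] (hK : Module.finrank k K = 2) {α : K}
    (hα : α ∉ Set.range (algebraMap k K)) (hα2 : α ^ 2 ∈ Set.range (algebraMap k K))
    {σ : K ≃ₐ[k] K} (hσ : σ ≠ 1) (R : Type*) [CommRing R] [Algebra k R] (X : G (R ⊗[k] K))
    (hX : G.map (conj σ R : R ⊗[k] K →+* R ⊗[k] K) X = X) : X ∈ (G.map (incL k K R)).range := by
  have key (Y : G (R ⊗[k] K)) (hY : G.map (conj σ R : R ⊗[k] K →+* R ⊗[k] K) Y = Y) :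
      ∃ M : Matrix (Fin 7) (Fin 7) R, M.map (incL k K R) = Y.1.1 := by
    have h (i j : Fin 7) : ∃ r : R, r ⊗ₜ[k] (1 : K) = Y.1.1 i j := by
      refine conj_fixed hK hα hα2 hσ R _ ?_
      conv_rhs => rw [← hY]
      rfl
    choose M hM using h
    exact ⟨Matrix.of M, Matrix.ext hM⟩
  obtain ⟨M, hM⟩ := key X hX
  obtain ⟨N, hN⟩ := key X⁻¹ (by rw [map_inv, hX])
  have hinj : Function.Injective fun A : Matrix (Fin 7) (Fin 7) R => A.map (incL k K R) :=
    Matrix.map_injective (incL_injective k K R)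
  have hMN : M * N = 1 := by
    apply hinj
    simp only [Matrix.map_mul, hM, hN]
    have h : X.1.1 * (X⁻¹).1.1 = 1 := by
      rw [← Units.val_mul, ← Subgroup.coe_mul, mul_inv_cancel]
      rfl
    rw [h]
    simp
  obtain ⟨c, hc⟩ := X.2
  rw [act_iff] at hc
  have hc1 : incL k K R (coordw M ![1, 2, 3]) = c := by
    rw [← coordw_map, hM, hc _ (by decide), coordw_one_123, mul_one]
  refine ⟨⟨⟨M, N, hMN, mul_eq_one_comm.1 hMN⟩, mem_of_act _ (coordw M ![1, 2, 3]) ?_⟩, ?_⟩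
  · rw [act_iff]
    intro r hr
    apply incL_injective k K R
    rw [← coordw_map, map_mul, hc1, ← coordw_one_map, hM, hc r hr]
  · exact G.ext' fun i j => congrFun (congrFun hM i) j

lemma SU.conj_eq {σ : K ≃ₐ[k] K} {R : Type*} [CommRing R] [Algebra k R] (A : SU σ R) :
    A.1.1.map (conj σ R) = Lam _ * (A.1⁻¹).1.transpose * Lam _ := by
  have hA : A.1.1 * Lam (R ⊗[k] K) * conjTr σ R A.1.1 = Lam (R ⊗[k] K) := A.2
  have h1 : (A.1⁻¹).1 * A.1.1 = 1 := by
    rw [← Matrix.SpecialLinearGroup.coe_mul, inv_mul_cancel, Matrix.SpecialLinearGroup.coe_one]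
  have h2 : conjTr σ R A.1.1 = Lam _ * (A.1⁻¹).1 * Lam _ := by
    calc conjTr σ R A.1.1
        = (Lam _ * Lam _) * conjTr σ R A.1.1 := by rw [Lam_mul_Lam, one_mul]
      _ = Lam _ * ((A.1⁻¹).1 * A.1.1) * (Lam _ * conjTr σ R A.1.1) := by
          rw [h1, mul_one, mul_assoc]
      _ = Lam _ * (A.1⁻¹).1 * (A.1.1 * Lam _ * conjTr σ R A.1.1) := by simp only [mul_assoc]
      _ = _ := by rw [hA]
  have h3 := congrArg Matrix.transpose h2
  rw [conjTr, Matrix.transpose_transpose] at h3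
  rw [h3, Matrix.transpose_mul, Matrix.transpose_mul, Lam_transpose, mul_assoc]

/-- `g_α` as an element of `G(R ⊗ K)`. -/
noncomputable def gT [CharZero k] {α : K} (hα : α ∉ Set.range (algebraMap k K)) (R : Type*)
    [CommRing R] [Algebra k R] : G (R ⊗[k] K) :=
  G.map (incR k K R) (gAlpha (two_ne k K) (ne_zero_of_notMem hα))

/-- The homomorphism `SL(3)_{R ⊗ K} → G(R ⊗ K)`, `A ↦ g_α d(A) g_α⁻¹`. -/
noncomputable def conjEmb [CharZero k] {α : K} (hα : α ∉ Set.range (algebraMap k K)) (R : Type*)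
    [CommRing R] [Algebra k R] :
    Matrix.SpecialLinearGroup (Fin 3) (R ⊗[k] K) →* G (R ⊗[k] K) :=
  (MulAut.conj (gT hα R)).toMonoidHom.comp (d (R ⊗[k] K))

lemma conjEmb_apply [CharZero k] {α : K} (hα : α ∉ Set.range (algebraMap k K)) (R : Type*)
    [CommRing R] [Algebra k R] (A : Matrix.SpecialLinearGroup (Fin 3) (R ⊗[k] K)) :
    conjEmb hα R A = gT hα R * d _ A * (gT hα R)⁻¹ := rfl

lemma gT_coe [CharZero k] {α : K} (hα : α ∉ Set.range (algebraMap k K)) (R : Type*)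
    [CommRing R] [Algebra k R] : (gT hα R).1.1 = (gMat α).map (incR k K R) := rfl

lemma d_coe {T : Type*} [CommRing T] (A : Matrix.SpecialLinearGroup (Fin 3) T) :
    (d T A).1.1 = blk A.1 (A⁻¹).1.transpose := rfl

lemma gT_conj [CharZero k] (hK : Module.finrank k K = 2) {α : K}
    (hα : α ∉ Set.range (algebraMap k K)) (hα2 : α ^ 2 ∈ Set.range (algebraMap k K))
    {σ : K ≃ₐ[k] K} (hσ : σ ≠ 1) (R : Type*) [CommRing R] [Algebra k R] :
    (gT hα R).1.1.map (conj σ R) = (gT hα R).1.1 * tau _ := by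
  have h : (gMat α).map (σ : K →+* K) = gMat α * tau K := by
    rw [gMat_map, ← gMat_neg]
    congr 1
    exact sigma_alpha hK hα hα2 hσ
  rw [gT_coe, ← tau_map (incR k K R), ← Matrix.map_mul, ← h]
  ext i j
  simp [incR, conj]

/-- For `A ∈ SU(R)`, the matrix `g_α d(A) g_α⁻¹` is fixed by `σ`. -/
lemma conjEmb_fixed [CharZero k] (hK : Module.finrank k K = 2) {α : K}
    (hα : α ∉ Set.range (algebraMap k K)) (hα2 : α ^ 2 ∈ Set.range (algebraMap k K))
    {σ : K ≃ₐ[k] K} (hσ : σ ≠ 1) (R : Type*) [CommRing R] [Algebra k R] (A : SU σ R) :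
    G.map (conj σ R : R ⊗[k] K →+* R ⊗[k] K) (conjEmb hα R A.1) = conjEmb hα R A.1 := by
  have hd : (G.map (conj σ R : R ⊗[k] K →+* R ⊗[k] K) (d _ A.1)).1.1 =
      blk (Lam _ * (A.1⁻¹).1.transpose * Lam _) (Lam _ * A.1.1 * Lam _) := by
    change (blk A.1.1 (A.1⁻¹).1.transpose).map (conj σ R : R ⊗[k] K →+* R ⊗[k] K) = _
    rw [blk_map]
    congr 1
    · exact SU.conj_eq A
    · have h := congrArg Matrix.transpose (SU.conj_eq A⁻¹)
      rw [Matrix.transpose_mul, Matrix.transpose_mul, Lam_transpose, Matrix.transpose_transpose,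
        ← mul_assoc, Subgroup.coe_inv, inv_inv] at h
      exact h
  rw [conjEmb_apply, map_mul, map_mul, map_inv, mul_inv_eq_iff_eq_mul]
  have key : G.map (conj σ R : R ⊗[k] K →+* R ⊗[k] K) (gT hα R) *
      G.map (conj σ R : R ⊗[k] K →+* R ⊗[k] K) (d _ A.1) =
      gT hα R * d _ A.1 * (gT hα R)⁻¹ * G.map (conj σ R : R ⊗[k] K →+* R ⊗[k] K) (gT hα R) := by
    refine Subtype.ext (Units.ext ?_)
    have h1 : (G.map (conj σ R : R ⊗[k] K →+* R ⊗[k] K) (gT hα R)).1.1 =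
        (gT hα R).1.1 * tau _ := gT_conj hK hα hα2 hσ R
    have h2 : ((gT hα R)⁻¹).1.1 * (gT hα R).1.1 = 1 := by
      rw [← Units.val_mul, ← Subgroup.coe_mul, inv_mul_cancel]
      rfl
    simp only [Subgroup.coe_mul, Units.val_mul]
    rw [h1, hd, mul_assoc, tau_mul_blk, mul_assoc, ← mul_assoc ((gT hα R)⁻¹).1.1, h2, one_mul, d_coe,
      mul_assoc]
  exact key

/-- The homomorphism `SU_α(2,1)(R) → G(R)`, `A ↦ g_α d(A) g_α⁻¹`: the matrix on the right has
entries in `R ⊗ K`, it is fixed by `σ`, and so it is the image of a unique element of `G(R)`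
(see `emb_spec`). -/
noncomputable def emb [CharZero k] (hK : Module.finrank k K = 2) {α : K}
    (hα : α ∉ Set.range (algebraMap k K)) (hα2 : α ^ 2 ∈ Set.range (algebraMap k K))
    {σ : K ≃ₐ[k] K} (hσ : σ ≠ 1) (R : Type*) [CommRing R] [Algebra k R] : SU σ R →* G R :=
  (MonoidHom.ofInjective (G.map_injective (incL_injective k K R))).symm.toMonoidHom.comp
    (((conjEmb hα R).comp (SU σ R).subtype).codRestrict (G.map (incL k K R)).range
      (fun A => G.descent hK hα hα2 hσ R _ (conjEmb_fixed hK hα hα2 hσ R A)))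

lemma emb_spec [CharZero k] (hK : Module.finrank k K = 2) {α : K}
    (hα : α ∉ Set.range (algebraMap k K)) (hα2 : α ^ 2 ∈ Set.range (algebraMap k K))
    {σ : K ≃ₐ[k] K} (hσ : σ ≠ 1) (R : Type*) [CommRing R] [Algebra k R] (A : SU σ R) :
    G.map (incL k K R) (emb hK hα hα2 hσ R A) = gT hα R * d _ A.1 * (gT hα R)⁻¹ := by
  rw [← conjEmb_apply]
  exact congrArg Subtype.val
    ((MonoidHom.ofInjective (G.map_injective (incL_injective k K R))).apply_symm_apply _)

/-- The homomorphisms `emb` are natural in the `k`-algebra `R`. -/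
lemma emb_natural [CharZero k] (hK : Module.finrank k K = 2) {α : K}
    (hα : α ∉ Set.range (algebraMap k K)) (hα2 : α ^ 2 ∈ Set.range (algebraMap k K))
    {σ : K ≃ₐ[k] K} (hσ : σ ≠ 1) {R S : Type*} [CommRing R] [Algebra k R] [CommRing S]
    [Algebra k S] (f : R →ₐ[k] S) (A : SU σ R) :
    emb hK hα hα2 hσ S (SU.map σ f A) = G.map (f : R →+* S) (emb hK hα hα2 hσ R A) := by
  let F : R ⊗[k] K →+* S ⊗[k] K := (baseMap f : R ⊗[k] K →ₐ[k] S ⊗[k] K)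
  apply G.map_injective (incL_injective k K S)
  have h1 (X : G R) : G.map (incL k K S) (G.map (f : R →+* S) X) =
      G.map F (G.map (incL k K R) X) := by
    refine G.ext' fun i j => ?_
    simp only [G.map_apply]
    simp [F, incL, baseMap]
  have h2 : G.map F (gT hα R) = gT hα S := by
    refine G.ext' fun i j => ?_
    simp only [gT, G.map_apply]
    simp [F, incR, baseMap]
  have h3 : G.map F (d _ A.1) = d _ (SU.map σ f A).1 := by
    refine Subtype.ext (Units.ext ?_)
    change (blk A.1.1 (A.1⁻¹).1.transpose).map F = blk _ _
    rw [blk_map]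
    congr 1
    change ((A.1⁻¹).1.map F).transpose = _
    congr 1
    exact congrArg Subtype.val (map_inv (Matrix.SpecialLinearGroup.map F) A.1)
  rw [h1, emb_spec, emb_spec, map_mul, map_mul, map_inv, h2, h3]

/-- The homomorphism `SU_α(2,1)(L) → G(L)` commutes with the action of `Gal(L/k)`. -/
lemma emb_smul [CharZero k] (hK : Module.finrank k K = 2) {α : K}
    (hα : α ∉ Set.range (algebraMap k K)) (hα2 : α ^ 2 ∈ Set.range (algebraMap k K))
    {σ : K ≃ₐ[k] K} (hσ : σ ≠ 1) (L : Type*) [Field L] [Algebra k L] (η : L ≃ₐ[k] L)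
    (A : SU σ L) : emb hK hα hα2 hσ L (η • A) = η • emb hK hα hα2 hσ L A :=
  emb_natural hK hα hα2 hσ (η : L →ₐ[k] L) A

end Embed

/-- The map `H¹(k, SU_α(2,1)) → H¹(k, G)` induced by `A ↦ g_α d(A) g_α⁻¹`. -/
noncomputable def H1SUtoG {k K : Type*} [Field k] [CharZero k] [Field K] [Algebra k K]
    (hK : Module.finrank k K = 2) {α : K} (hα : α ∉ Set.range (algebraMap k K))
    (hα2 : α ^ 2 ∈ Set.range (algebraMap k K)) {σ : K ≃ₐ[k] K} (hσ : σ ≠ 1) :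
    NonabelianH1.H1 (AlgebraicClosure k ≃ₐ[k] AlgebraicClosure k) (SU σ (AlgebraicClosure k)) →
      NonabelianH1.H1 (AlgebraicClosure k ≃ₐ[k] AlgebraicClosure k) (G (AlgebraicClosure k)) :=
  NonabelianH1.H1.map (emb hK hα hα2 hσ (AlgebraicClosure k))
    (emb_smul hK hα hα2 hσ (AlgebraicClosure k))

end G2Prehom

/-! The forms `tri`, `bil` and `cross` on row vectors are, up to normalisation, those of the
trace-zero octonions. `G` consists of the matrices that multiply `tri` by a unit. Over a field of
characteristic zero such a matrix also multiplies `bil` by a constant, and there is a scalar `t`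
with `tri` multiplied by `t ^ 3` and `bil` by `t ^ 2` (`exists_similitude`). So `G` is the product
of the scalars and a group of type G₂, the isometries with `t = 1`.

The image of `SU_α(2,1)` is exactly the stabiliser, among these isometries, of a row vector `v` over
`k` with `bil v v ≠ 0`, namely the first row of `g_α⁻¹` (`fixedRow_vecMul_emb`, `exists_emb_eq`).
This comes from two facts: an isometry fixing `e₁` is some `d(B)` with `B ∈ SL(3)` (`exists_eq_d`),
and `σ(g_α) = g_α τ` turns σ-invariance of `g_α d(B) g_α⁻¹` into the unitary condition on `B`.

Now let `h` and `i` be cocycles in `SU_α(2,1)` that become equivalent in `G` through `g`. Since `t`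
is determined by `g`, it is Galois invariant, and dividing by it makes `g` an isometry
(`exists_isometry_equiv`). Twist the Galois action on row vectors by `i`. Both `v` and `v g⁻¹` are
fixed by the twisted action and have the same non-zero norm. If an isometry `S` commuting with the
twisted action sends `v` to `v g⁻¹`, then `S g` fixes `v`, hence comes from some `A` in `SU_α(2,1)`,
and `A` is an equivalence between `h` and `i`.

It remains to see that the rational points of the twisted group act transitively on rational vectors
of a given non-zero norm (`IsTwistedAction.movable`). The elements used are the involutions attached
to quaternion subalgebras: for orthogonal non-isotropic `a`, `b`, the map that is `1` on the span of
`a`, `b`, `a × b` and `-1` on its complement preserves `tri` (`tri_invol`), and it is rational when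
`a` and `b` are. With `a = u + v` and `b` orthogonal to `a`, `u - v` and `(u - v) × a`, it exchanges
`u` and `v`. A rational non-isotropic `b` exists because rational vectors span every stable subspace
(`IsTwistedAction.mem_span_fixed`), and a space of dimension at least 4 in a non-degenerate
7-dimensional space is not totally isotropic (`IsTwistedAction.exists_fixed_perp`). -/

namespace G2Prehom

/-! ### The trilinear form, the bilinear form and the cross product on row vectors -/

section Forms

variable {R : Type*} [CommRing R]

/-- The alternating trilinear form on row vectors obtained by pairing with `w̄`. -/
def tri (x y z : Fin 7 → R) : R :=
  let m (a b c : Fin 7) : R := x a * (y b * z c - y c * z b) -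
    x b * (y a * z c - y c * z a) + x c * (y a * z b - y b * z a)
  m 1 2 3 + m 4 5 6 + (m 0 1 4 + m 0 2 5 + m 0 3 6)

/-- The invariant symmetric bilinear form on row vectors. -/
def bil (x y : Fin 7 → R) : R :=
  2 * (x 0 * y 0) - (x 1 * y 4 + x 4 * y 1) - (x 2 * y 5 + x 5 * y 2) - (x 3 * y 6 + x 6 * y 3)

/-- The cross product, characterised by `bil (cross x y) z = 2 * tri x y z`. -/
def cross (x y : Fin 7 → R) : Fin 7 → R :=
  ![x 1 * y 4 - x 4 * y 1 + (x 2 * y 5 - x 5 * y 2) + (x 3 * y 6 - x 6 * y 3),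
    -2 * (x 5 * y 6 - x 6 * y 5 + x 0 * y 1 - x 1 * y 0),
    -2 * (x 6 * y 4 - x 4 * y 6 + x 0 * y 2 - x 2 * y 0),
    -2 * (x 4 * y 5 - x 5 * y 4 + x 0 * y 3 - x 3 * y 0),
    -2 * (x 2 * y 3 - x 3 * y 2 - x 0 * y 4 + x 4 * y 0),
    -2 * (x 3 * y 1 - x 1 * y 3 - x 0 * y 5 + x 5 * y 0),
    -2 * (x 1 * y 2 - x 2 * y 1 - x 0 * y 6 + x 6 * y 0)]

lemma tri_add_left (x x' y z : Fin 7 → R) : tri (x + x') y z = tri x y z + tri x' y z := by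
  simp only [tri, Pi.add_apply]; ring

lemma tri_smul_left (r : R) (x y z : Fin 7 → R) : tri (r • x) y z = r * tri x y z := by
  simp only [tri, Pi.smul_apply, smul_eq_mul]; ring

lemma tri_rotate (x y z : Fin 7 → R) : tri x y z = tri y z x := by
  simp only [tri]; ring

lemma tri_swap (x y z : Fin 7 → R) : tri x y z = -tri y x z := by
  simp only [tri]; ring

lemma tri_swap_right (x y z : Fin 7 → R) : tri x y z = -tri x z y := by
  simp only [tri]; ring

lemma tri_add_mid (x y y' z : Fin 7 → R) : tri x (y + y') z = tri x y z + tri x y' z := by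
  simp only [tri, Pi.add_apply]; ring

lemma tri_add_right (x y z z' : Fin 7 → R) : tri x y (z + z') = tri x y z + tri x y z' := by
  simp only [tri, Pi.add_apply]; ring

lemma tri_smul_mid (r : R) (x y z : Fin 7 → R) : tri x (r • y) z = r * tri x y z := by
  simp only [tri, Pi.smul_apply, smul_eq_mul]; ring

lemma tri_smul_right (r : R) (x y z : Fin 7 → R) : tri x y (r • z) = r * tri x y z := by
  simp only [tri, Pi.smul_apply, smul_eq_mul]; ring

lemma bil_comm (x y : Fin 7 → R) : bil x y = bil y x := by
  simp only [bil]; ring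

lemma bil_add_left (x x' y : Fin 7 → R) : bil (x + x') y = bil x y + bil x' y := by
  simp only [bil, Pi.add_apply]; ring

lemma bil_smul_left (r : R) (x y : Fin 7 → R) : bil (r • x) y = r * bil x y := by
  simp only [bil, Pi.smul_apply, smul_eq_mul]; ring

lemma bil_add_right (x y y' : Fin 7 → R) : bil x (y + y') = bil x y + bil x y' := by
  simp only [bil, Pi.add_apply]; ring

lemma bil_smul_right (r : R) (x y : Fin 7 → R) : bil x (r • y) = r * bil x y := by
  simp only [bil, Pi.smul_apply, smul_eq_mul]; ring

lemma cross_smul_right (r : R) (x y : Fin 7 → R) : cross x (r • y) = r • cross x y := by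
  ext i
  fin_cases i <;> simp [cross] <;> ring

lemma cross_swap (x y : Fin 7 → R) : cross x y = -cross y x := by
  ext i
  fin_cases i <;> simp [cross] <;> ring

lemma bil_cross (x y z : Fin 7 → R) : bil (cross x y) z = 2 * tri x y z := by
  simp [bil, cross, tri]; ring

/-- Polarisation of `cross_cross_self` in `x`. For orthogonal `x`, `y` it says that `cross x` and
`cross y` anticommute on the vectors orthogonal to both. -/
lemma cross_cross_add (x y z : Fin 7 → R) :
    cross x (cross y z) + cross y (cross x z) =
      (4 * bil x y) • z - (2 * bil x z) • y - (2 * bil y z) • x := by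
  ext i
  fin_cases i <;> simp [cross, bil] <;> ring

lemma cross_cross_self (x y : Fin 7 → R) :
    cross x (cross x y) = (2 * bil x x) • y - (2 * bil x y) • x := by
  ext i
  fin_cases i <;> simp [cross, bil] <;> ring

lemma tri_self_left (x y : Fin 7 → R) : tri x x y = 0 := by
  simp only [tri]; ring

/-- The correction term vanishes when `x`, `y`, `z` are orthogonal to `a`, so there `cross a` can be
moved freely between the slots of `tri`. -/
lemma tri_cross_swap (a x y z : Fin 7 → R) : tri (cross a x) y z = tri x (cross a y) z +
    (2 * bil x y * bil a z - bil x z * bil y a - bil y z * bil x a) := by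
  simp [tri, cross, bil]; ring

lemma bil_single (x : Fin 7 → R) :
    bil x (e R 0) = 2 * x 0 ∧ bil x (e R 1) = -x 4 ∧ bil x (e R 2) = -x 5 ∧ bil x (e R 3) = -x 6 ∧
    bil x (e R 4) = -x 1 ∧ bil x (e R 5) = -x 2 ∧ bil x (e R 6) = -x 3 := by
  simp [bil, e]

/-- The bilinear form is non-degenerate if `2` is not a zero divisor. -/
lemma eq_of_bil_eq (h2 : IsUnit (2 : R)) {x y : Fin 7 → R} (h : ∀ z, bil x z = bil y z) :
    x = y := by
  obtain ⟨x0, x1, x2, x3, x4, x5, x6⟩ := bil_single x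
  obtain ⟨y0, y1, y2, y3, y4, y5, y6⟩ := bil_single y
  rw [h] at x0 x1 x2 x3 x4 x5 x6
  ext i
  fin_cases i <;> simp
  · exact h2.mul_left_cancel (x0.symm.trans y0)
  · exact neg_injective (x4.symm.trans y4)
  · exact neg_injective (x5.symm.trans y5)
  · exact neg_injective (x6.symm.trans y6)
  · exact neg_injective (x1.symm.trans y1)
  · exact neg_injective (x2.symm.trans y2)
  · exact neg_injective (x3.symm.trans y3)

lemma tri_map {S : Type*} [CommRing S] (f : R →+* S) (x y z : Fin 7 → R) :
    tri (f ∘ x) (f ∘ y) (f ∘ z) = f (tri x y z) := by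
  simp [tri]

lemma bil_map {S : Type*} [CommRing S] (f : R →+* S) (x y : Fin 7 → R) :
    bil (f ∘ x) (f ∘ y) = f (bil x y) := by
  simp [bil, map_ofNat]

/-- The linear form on the third exterior power defined by three row vectors. -/
noncomputable def rowForm (f : Fin 3 → Fin 7 → R) : Module.Dual R (⋀[R]^3 (Fin 7 → R)) :=
  exteriorPower.pairingDual R (Fin 7 → R) 3
    (exteriorPower.ιMulti R 3 (fun i => Fintype.linearCombination R (f i)))

lemma rowForm_wedge (g : Matrix (Fin 7) (Fin 7) R) (f : Fin 3 → Fin 7 → R) (i j k : Fin 7) :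
    rowForm f (act3 g (wedge R i j k)) =
      Matrix.det (Matrix.of fun a b => (Matrix.vecMul (f a) g) (![i, j, k] b)) := by
  rw [rowForm, act3, wedge, exteriorPower.map_apply_ιMulti,
    exteriorPower.pairingDual_ιMulti_ιMulti, ← Matrix.det_transpose]
  congr 1
  ext a b
  fin_cases b <;>
    simp [e, Matrix.mulVec_single, Fintype.linearCombination_apply, Matrix.vecMul, dotProduct,
      mul_comm]

lemma rowForm_act (g : Matrix (Fin 7) (Fin 7) R) (f : Fin 3 → Fin 7 → R) :
    rowForm f (act3 g (wbar R)) =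
      tri (Matrix.vecMul (f 0) g) (Matrix.vecMul (f 1) g) (Matrix.vecMul (f 2) g) := by
  simp only [wbar, map_add, rowForm_wedge, Matrix.det_fin_three, Matrix.of_apply, tri]
  simp only [Matrix.cons_val]
  ring

lemma coordw_eq_tri (g : Matrix (Fin 7) (Fin 7) R) (r : Fin 3 → Fin 7) :
    coordw g r = tri (g (r 0)) (g (r 1)) (g (r 2)) := by
  rw [coordw_eq, coordw_expand]; rfl

/-- Elements of `G` are the matrices that multiply `tri` by a constant. -/
lemma act3_iff_tri (g : Matrix (Fin 7) (Fin 7) R) (c : R) :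
    act3 g (wbar R) = c • wbar R ↔ ∀ x y z : Fin 7 → R,
      tri (Matrix.vecMul x g) (Matrix.vecMul y g) (Matrix.vecMul z g) = c * tri x y z := by
  constructor
  · intro h x y z
    have h1 := rowForm_act g ![x, y, z]
    have h2 := rowForm_act 1 ![x, y, z]
    simp only [act3_one, LinearMap.id_apply, Matrix.vecMul_one] at h2
    rw [h, map_smul, h2, smul_eq_mul] at h1
    exact h1.symm
  · intro h
    rw [act_iff]
    intro r _
    have h1 := h (Pi.single (r 0) 1) (Pi.single (r 1) 1) (Pi.single (r 2) 1)
    rw [coordw_eq_tri, coordw_eq_tri]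
    have h3 (M : Matrix (Fin 7) (Fin 7) R) (i : Fin 7) : M i = Matrix.vecMul (Pi.single i 1) M := by
      simp [Matrix.row]
    simp only [h3]
    rw [Matrix.vecMul_one, Matrix.vecMul_one, Matrix.vecMul_one, h1]

end Forms

/-! ### Involutions attached to orthogonal pairs -/

section Involution

lemma bil_cross_cross {R : Type*} [CommRing R] (a b x : Fin 7 → R) :
    bil (cross a x) (cross a b) = 2 * (bil a x * bil a b) - 2 * (bil a a * bil x b) := by
  simp [bil, cross]; ring

variable {F : Type*} [Field F] [CharZero F]

lemma tri_eq_zero_of_bil_cross {x y z : Fin 7 → F} (h : bil (cross x y) z = 0) :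
    tri x y z = 0 := by
  rw [bil_cross] at h
  simpa using h

/-- `x` is orthogonal to `a`, `b` and `cross a b`. -/
def IsPerp (a b x : Fin 7 → F) : Prop := bil a x = 0 ∧ bil b x = 0 ∧ bil (cross a b) x = 0

omit [CharZero F] in
lemma IsPerp.cross_left {a b x : Fin 7 → F} (h : IsPerp a b x) :
    IsPerp a b (cross a x) := by
  obtain ⟨h1, h2, h3⟩ := h
  refine ⟨?_, ?_, ?_⟩
  · rw [bil_comm, bil_cross, tri_rotate, tri_rotate, tri_self_left, mul_zero]
  · rw [bil_cross] at h3
    rw [bil_comm, bil_cross, tri_swap_right]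
    linear_combination -h3
  · rw [bil_comm, bil_cross_cross a b x, h1, bil_comm x b, h2]
    ring

omit [CharZero F] in
lemma IsPerp.cross_right {a b x : Fin 7 → F} (h : IsPerp a b x) :
    IsPerp a b (cross b x) := by
  obtain ⟨h1, h2, h3⟩ := h
  have h3' : bil (cross b a) x = 0 := by
    rw [bil_cross] at h3 ⊢
    rw [tri_swap]; linear_combination -h3
  obtain ⟨k1, k2, k3⟩ := IsPerp.cross_left ⟨h2, h1, h3'⟩
  refine ⟨k2, k1, ?_⟩
  rw [bil_cross] at k3 ⊢
  rw [tri_swap]; linear_combination -k3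

/-- Three vectors orthogonal to a quaternion subalgebra are orthogonal for the trilinear form. -/
lemma tri_eq_zero_of_perp {a b x y z : Fin 7 → F} (hab : bil a b = 0) (ha : bil a a ≠ 0)
    (hb : bil b b ≠ 0) (hx : IsPerp a b x) (hy : IsPerp a b y) (hz : IsPerp a b z) :
    tri x y z = 0 := by
  have swapa {x y z : Fin 7 → F} (hx : IsPerp a b x) (hy : IsPerp a b y) (hz : IsPerp a b z) :
      tri (cross a x) y z = tri x (cross a y) z := by
    rw [tri_cross_swap, hz.1, bil_comm y a, hy.1, bil_comm x a, hx.1]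
    ring
  have swapb {x y z : Fin 7 → F} (hx : IsPerp a b x) (hy : IsPerp a b y) (hz : IsPerp a b z) :
      tri (cross b x) y z = tri x (cross b y) z := by
    rw [tri_cross_swap, hz.2.1, bil_comm y b, hy.2.1, bil_comm x b, hx.2.1]
    ring
  have swapb' {x y z : Fin 7 → F} (hx : IsPerp a b x) (hy : IsPerp a b y) (hz : IsPerp a b z) :
      tri (cross b x) y z = tri x y (cross b z) := by
    rw [tri_rotate, tri_rotate, ← swapb hz hx hy, tri_rotate]
  have anti {x : Fin 7 → F} (hx : IsPerp a b x) :
      cross a (cross b x) = (-1 : F) • cross b (cross a x) := by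
    have h := cross_cross_add a b x
    rw [hab, hx.1, hx.2.1] at h
    simp only [mul_zero, zero_smul, sub_zero] at h
    rw [eq_neg_of_add_eq_zero_left h, neg_one_smul]
  -- Moving the two operators to different slots and back reverses their order, while on `x` they
  -- anticommute; so the value equals its own negative.
  have key {x : Fin 7 → F} (hx : IsPerp a b x) : tri (cross a (cross b x)) y z = 0 := by
    have h1 : tri (cross a (cross b x)) y z = tri (cross b (cross a x)) y z := by
      rw [swapa hx.cross_right hy hz, swapb' hx hy.cross_left hz, ← swapa hx hy hz.cross_right,
        swapb' hx.cross_left hy hz]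
    rw [anti hx, tri_smul_left] at h1 ⊢
    have : (2 : F) * tri (cross b (cross a x)) y z = 0 := by linear_combination -h1
    simpa using this
  -- Applied to `b × (a × x)`, the four cross products collapse to the non-zero multiple `4 (bil a
  -- a)(bil b b)` of `x`.
  have h := key ((hx.cross_left).cross_right)
  rw [cross_cross_self, (hx.cross_left).2.1, mul_zero, zero_smul, sub_zero, cross_smul_right,
    tri_smul_left, cross_cross_self, hx.1, mul_zero, zero_smul, sub_zero, tri_smul_left] at h
  simpa [ha, hb] using h

/-- The projection to the span of `a`, `b` and `cross a b`. -/
def proj (a b x : Fin 7 → F) : Fin 7 → F :=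
  (bil a x / bil a a) • a + (bil b x / bil b b) • b +
    (bil (cross a b) x / bil (cross a b) (cross a b)) • cross a b

/-- The involution that is `1` on the span of `a`, `b` and `cross a b`, and `-1` on its orthogonal
complement. -/
def invol (a b x : Fin 7 → F) : Fin 7 → F := (2 : F) • proj a b x + (-1 : F) • x

variable {a b : Fin 7 → F}

omit [CharZero F] in
lemma bil_cross_self (hab : bil a b = 0) :
    bil (cross a b) (cross a b) = -2 * (bil a a * bil b b) := by
  rw [bil_cross_cross, hab]; ring

omit [CharZero F] in
lemma bil_left_cross : bil a (cross a b) = 0 := by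
  rw [bil_comm, bil_cross, ← tri_rotate a a b, tri_self_left, mul_zero]

omit [CharZero F] in
lemma bil_right_cross : bil b (cross a b) = 0 := by
  rw [bil_comm, bil_cross, tri_rotate, tri_self_left, mul_zero]

/-- The vectors `a`, `b`, `cross a b` are pairwise orthogonal with non-zero norms, so `proj` is the
orthogonal projection. -/
lemma isPerp_sub_proj (hab : bil a b = 0) (ha : bil a a ≠ 0) (hb : bil b b ≠ 0)
    (x : Fin 7 → F) : IsPerp a b (x + (-1 : F) • proj a b x) := by
  have hba : bil b a = 0 := by rwa [bil_comm]
  have hp : bil (cross a b) (cross a b) ≠ 0 := by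
    rw [bil_cross_self hab]
    simp [ha, hb]
  have h1 : bil (cross a b) a = 0 := by rw [bil_comm, bil_left_cross]
  have h2 : bil (cross a b) b = 0 := by rw [bil_comm, bil_right_cross]
  refine ⟨?_, ?_, ?_⟩ <;>
    simp only [proj, bil_add_right, bil_smul_right, bil_left_cross, bil_right_cross, h1, h2, hab,
      hba] <;> field_simp <;> ring

/-- The span of `a`, `b`, `cross a b` is closed under `cross` (imaginary quaternions), and `z` is
orthogonal to it. -/
lemma tri_proj_proj_perp (hab : bil a b = 0) {z : Fin 7 → F} (hz : IsPerp a b z)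
    (x y : Fin 7 → F) : tri (proj a b x) (proj a b y) z = 0 := by
  have hba : bil b a = 0 := by rwa [bil_comm]
  have h1 : tri a b z = 0 := tri_eq_zero_of_bil_cross hz.2.2
  have h2 : tri a (cross a b) z = 0 := by
    apply tri_eq_zero_of_bil_cross
    rw [cross_cross_self, hab, mul_zero, zero_smul, sub_zero, bil_smul_left, hz.2.1, mul_zero]
  have h3 : tri b (cross a b) z = 0 := by
    apply tri_eq_zero_of_bil_cross
    rw [cross_swap a b, ← neg_one_smul F, cross_smul_right, cross_cross_self, hba, mul_zero,
      zero_smul, sub_zero, bil_smul_left, bil_smul_left, hz.1, mul_zero, mul_zero]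
  have h1' : tri b a z = 0 := by rw [tri_swap, h1, neg_zero]
  have h2' : tri (cross a b) a z = 0 := by rw [tri_swap, h2, neg_zero]
  have h3' : tri (cross a b) b z = 0 := by rw [tri_swap, h3, neg_zero]
  simp only [proj, tri_add_left, tri_add_mid, tri_smul_left, tri_smul_mid, h1, h2, h3, h1', h2',
    h3', tri_self_left]
  ring

/-- The involution attached to an orthogonal pair preserves the trilinear form. -/
lemma tri_invol (hab : bil a b = 0) (ha : bil a a ≠ 0) (hb : bil b b ≠ 0) (x y z : Fin 7 → F) :
    tri (invol a b x) (invol a b y) (invol a b z) = tri x y z := by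
  have split (x : Fin 7 → F) : ∃ p q : Fin 7 → F, x = p + q ∧ IsPerp a b q ∧
      p = proj a b x ∧ invol a b x = p + (-1 : F) • q := by
    refine ⟨proj a b x, x + (-1 : F) • proj a b x, ?_, isPerp_sub_proj hab ha hb x, rfl, ?_⟩
    · module
    · rw [invol]; module
  obtain ⟨px, qx, hx, hqx, hpx, ex⟩ := split x
  obtain ⟨py, qy, hy, hqy, hpy, ey⟩ := split y
  obtain ⟨pz, qz, hz, hqz, hpz, ez⟩ := split z
  have h0 : tri qx qy qz = 0 := tri_eq_zero_of_perp hab ha hb hqx hqy hqz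
  have h1 : tri px py qz = 0 := hpx ▸ hpy ▸ tri_proj_proj_perp hab hqz x y
  have h2 : tri qx py pz = 0 := by
    rw [tri_rotate]; exact hpy ▸ hpz ▸ tri_proj_proj_perp hab hqx y z
  have h3 : tri px qy pz = 0 := by
    rw [← tri_rotate]; exact hpz ▸ hpx ▸ tri_proj_proj_perp hab hqy z x
  rw [ex, ey, ez]
  conv_rhs => rw [hx, hy, hz]
  -- The terms with an odd number of complementary factors, which would change sign, are zero; the
  -- others are unchanged.
  simp only [tri_add_left, tri_add_mid, tri_add_right, tri_smul_left, tri_smul_mid,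
    tri_smul_right, h0, h1, h2, h3]
  ring

lemma bil_invol (hab : bil a b = 0) (ha : bil a a ≠ 0) (hb : bil b b ≠ 0) (x y : Fin 7 → F) :
    bil (invol a b x) (invol a b y) = bil x y := by
  have hba : bil b a = 0 := by rwa [bil_comm]
  have hp : bil (cross a b) (cross a b) ≠ 0 := by
    rw [bil_cross_self hab]
    simp [ha, hb]
  have h1 : bil (cross a b) a = 0 := by rw [bil_comm, bil_left_cross]
  have h2 : bil (cross a b) b = 0 := by rw [bil_comm, bil_right_cross]
  simp only [invol, proj, bil_add_right, bil_smul_right, bil_add_left, bil_smul_left,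
    bil_left_cross, bil_right_cross, h1, h2, hab, hba, bil_comm x]
  field_simp
  ring

/-- A self-adjoint isometry of a non-degenerate form squares to the identity. -/
lemma invol_invol (hab : bil a b = 0) (ha : bil a a ≠ 0) (hb : bil b b ≠ 0) (x : Fin 7 → F) :
    invol a b (invol a b x) = x := by
  refine eq_of_bil_eq (isUnit_iff_ne_zero.2 two_ne_zero) fun z => ?_
  have hs (x y : Fin 7 → F) : bil (invol a b x) y = bil x (invol a b y) := by
    simp only [invol, proj, bil_add_left, bil_smul_left, bil_comm x]
    ring
  rw [hs, bil_invol hab ha hb]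

omit [CharZero F] in
lemma invol_add {p : Fin 7 → F} (q : Fin 7 → F) (hp : proj a b p = p) (hq : IsPerp a b q) :
    invol a b (p + q) = p + (-1 : F) • q := by
  have h : proj a b (p + q) = proj a b p := by
    simp only [proj, bil_add_right, hq.1, hq.2.1, hq.2.2, add_zero]
  rw [invol, h, hp]
  module

omit [CharZero F] in
lemma proj_left (hab : bil a b = 0) (ha : bil a a ≠ 0) : proj a b a = a := by
  have h1 : bil (cross a b) a = 0 := by rw [bil_comm, bil_left_cross]
  rw [proj, bil_comm b a, hab, h1, div_self ha]
  simp

end Involution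

/-! ### Elements of `G` are similitudes of the bilinear form -/

section Similitude

open Matrix

lemma vecMul_eq_rows {R : Type*} [CommRing R] (x : Fin 7 → R) (g : Matrix (Fin 7) (Fin 7) R) :
    x ᵥ* g = x 0 • g 0 + x 1 • g 1 + x 2 • g 2 + x 3 • g 3 + x 4 • g 4 + x 5 • g 5 + x 6 • g 6 := by
  ext i
  simp [vecMul, dotProduct, Fin.sum_univ_seven]

lemma bil_cross_vecMul {R : Type*} [CommRing R] {g : Matrix (Fin 7) (Fin 7) R} {c : R}
    (hg : ∀ x y z, tri (x ᵥ* g) (y ᵥ* g) (z ᵥ* g) = c * tri x y z) (x y z : Fin 7 → R) :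
    bil (cross (x ᵥ* g) (y ᵥ* g)) (z ᵥ* g) = c * bil (cross x y) z := by
  rw [bil_cross, bil_cross, hg]; ring

/-- A matrix preserving the trilinear form and the bilinear form preserves the cross product. -/
lemma cross_vecMul {R : Type*} [CommRing R] (h2 : IsUnit (2 : R))
    {g : Matrix (Fin 7) (Fin 7) R} (hgu : IsUnit g) {t : R}
    (hg : ∀ x y z, tri (x ᵥ* g) (y ᵥ* g) (z ᵥ* g) = t ^ 3 * tri x y z)
    (hb : ∀ x y, bil (x ᵥ* g) (y ᵥ* g) = t ^ 2 * bil x y) (x y : Fin 7 → R) :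
    cross (x ᵥ* g) (y ᵥ* g) = t • (cross x y ᵥ* g) := by
  obtain ⟨u, rfl⟩ := hgu
  refine eq_of_bil_eq h2 fun z => ?_
  have hz : z = (z ᵥ* (u⁻¹).1) ᵥ* u.1 := by rw [vecMul_vecMul, Units.inv_mul, vecMul_one]
  rw [hz, bil_cross_vecMul hg, bil_smul_left, hb]
  ring

variable {F : Type*} [Field F] [CharZero F]

-- By `cross_cross_self`, `f × f' = 0` makes `(bil f f) f'` a multiple of `f`. The indices `i`, `j`
-- exhibit a non-zero 2×2 minor, that is, linear independence of `f` and `f'`.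
omit [CharZero F] in
lemma bil_self_eq_zero [NeZero (2 : F)] {f f' : Fin 7 → F} (h : cross f f' = 0)
    (i j : Fin 7) (hij : f' i * f j ≠ f' j * f i) : bil f f = 0 := by
  by_contra hf
  have h1 := cross_cross_self f f'
  rw [h] at h1
  have h0 : cross f 0 = 0 := by
    ext i; fin_cases i <;> simp [cross]
  rw [h0] at h1
  have hi := congrFun h1 i
  have hj := congrFun h1 j
  simp only [Pi.zero_apply, Pi.sub_apply, Pi.smul_apply, smul_eq_mul] at hi hj
  have h2 : (2 * bil f f) * (f' i * f j - f' j * f i) = 0 := by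
    linear_combination f i * hj - f j * hi
  have h3 := sub_ne_zero.2 hij
  simp [hf, h3, NeZero.ne] at h2

-- Since `bil` is non-degenerate, `f × f' = 0` means that `tri f f'` vanishes identically, a
-- condition on `tri` alone and therefore preserved by `g`. This turns the invariance of `tri` into
-- information on `bil`.
omit [CharZero F] in
lemma bil_vecMul_self_eq_zero [NeZero (2 : F)] {g : Matrix (Fin 7) (Fin 7) F} (hgu : IsUnit g)
    {c : F} (hg : ∀ x y z, tri (x ᵥ* g) (y ᵥ* g) (z ᵥ* g) = c * tri x y z) {f : Fin 7 → F}
    (f' : Fin 7 → F) (h : cross f f' = 0) (i j : Fin 7) (hij : f' i * f j ≠ f' j * f i) :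
    bil (f ᵥ* g) (f ᵥ* g) = 0 := by
  obtain ⟨u, rfl⟩ := hgu
  have h2 : IsUnit (2 : F) := isUnit_iff_ne_zero.2 (NeZero.ne _)
  have hc : cross (f ᵥ* u.1) (f' ᵥ* u.1) = 0 := by
    refine eq_of_bil_eq h2 fun z => ?_
    have hz : z = (z ᵥ* (u⁻¹).1) ᵥ* u.1 := by rw [vecMul_vecMul, Units.inv_mul, vecMul_one]
    rw [hz, bil_cross_vecMul hg, h]
    simp [bil]
  by_contra hne
  have h1 (i j : Fin 7) : (f' ᵥ* u.1) i * (f ᵥ* u.1) j = (f' ᵥ* u.1) j * (f ᵥ* u.1) i := by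
    by_contra hij'
    exact hne (bil_self_eq_zero hc i j hij')
  obtain ⟨l, hl⟩ : ∃ l, (f ᵥ* u.1) l ≠ 0 := by
    by_contra! h0
    exact hne (by simp [bil, h0])
  have h3 : f' ᵥ* u.1 = ((f' ᵥ* u.1) l / (f ᵥ* u.1) l) • (f ᵥ* u.1) := by
    ext i
    rw [Pi.smul_apply, smul_eq_mul, div_mul_eq_mul_div, eq_div_iff hl, h1 i l]
  have h4 : f' = ((f' ᵥ* u.1) l / (f ᵥ* u.1) l) • f := by
    have h5 := congrArg (fun z => z ᵥ* (u⁻¹).1) h3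
    simpa only [smul_vecMul, vecMul_vecMul, Units.mul_inv, vecMul_one] using h5
  apply hij
  rw [h4]
  simp only [Pi.smul_apply, smul_eq_mul]
  ring

/-- The norm is a Laurent polynomial in `s` with terms in `s`, `1`, `s⁻¹`; its zeros at `1`, `-1`,
`2` kill all three coefficients. -/
lemma bil_of_null_pencil {p x y : Fin 7 → F} (hx : bil x x = 0) (hy : bil y y = 0)
    (h : ∀ s : F, s ≠ 0 → bil (p + s • x + s⁻¹ • y) (p + s • x + s⁻¹ • y) = 0) :
    bil p x = 0 ∧ bil p y = 0 ∧ bil x y = -(bil p p / 2) := by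
  have h1 := h 1 one_ne_zero
  have h2 := h (-1) (by simp)
  have h3 := h 2 two_ne_zero
  simp only [bil_add_left, bil_add_right, bil_smul_left, bil_smul_right, hx, hy, bil_comm x p,
    bil_comm y p, bil_comm y x] at h1 h2 h3
  norm_num at h1 h2 h3
  have e1 : bil p x = 0 := by
    linear_combination (-1 / 4 : F) * h1 + (-1 / 12 : F) * h2 + (1 / 3 : F) * h3
  have e2 : bil p y = 0 := by linear_combination (1 / 4 : F) * h1 - (1 / 4 : F) * h2 - e1
  refine ⟨e1, e2, ?_⟩
  linear_combination (1 / 4 : F) * h1 + (1 / 4 : F) * h2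

lemma bil_of_null_add {x y : Fin 7 → F} (hx : bil x x = 0) (hy : bil y y = 0)
    (h : bil (x + y) (x + y) = 0) : bil x y = 0 := by
  simp only [bil_add_left, bil_add_right, hx, hy, bil_comm y x] at h
  have : (2 : F) * bil x y = 0 := by linear_combination h
  simpa using this

set_option maxHeartbeats 1000000 in
/-- A matrix that multiplies `tri` by a constant also multiplies `bil` by a constant. -/
lemma exists_bil_vecMul {g : Matrix (Fin 7) (Fin 7) F} (hgu : IsUnit g) {c : F}
    (hg : ∀ x y z, tri (x ᵥ* g) (y ᵥ* g) (z ᵥ* g) = c * tri x y z) :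
    ∃ m, ∀ x y, bil (x ᵥ* g) (y ᵥ* g) = m * bil x y := by
  -- The Gram matrix of the rows of `g` is recovered from enough null vectors, each certified by an
  -- independent vector with which its cross product is zero.
  have n1 (i i' : Fin 7) (h : cross (e F i) (e F i') = 0) (hi : i' ≠ i) :
      bil (g i) (g i) = 0 := by
    have := bil_vecMul_self_eq_zero hgu hg (e F i') h i' i (by simp [e, hi])
    simpa [e, Matrix.row] using this
  have n2 (i j l : Fin 7) (h : cross (e F i + e F j) (e F l) = 0) (hij : i ≠ j)
      (hl : l ≠ j) : bil (g i + g j) (g i + g j) = 0 := by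
    have := bil_vecMul_self_eq_zero hgu hg (e F l) h l j (by simp [e, hij, hl, hl.symm])
    simpa [e, Matrix.row, add_vecMul] using this
  have n3 (i j p q : Fin 7) (h : ∀ s : F, s ≠ 0 →
      cross (e F 0 + s • e F i + s⁻¹ • e F j) (e F p + s • e F q) = 0) (hi : i ≠ 0) (hj : j ≠ 0)
      (hp : p ≠ 0) (hq : q ≠ 0) (hpi : p ≠ i) (hpj : p ≠ j) (hpq : p ≠ q) (s : F) (hs : s ≠ 0) :
      bil (g 0 + s • g i + s⁻¹ • g j) (g 0 + s • g i + s⁻¹ • g j) = 0 := by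
    have := bil_vecMul_self_eq_zero hgu hg (e F p + s • e F q) (h s hs) p 0
      (by simp [e, hi.symm, hj.symm, hp, hp.symm, hq.symm, hpi, hpj, hpq])
    simpa [e, Matrix.row, add_vecMul, smul_vecMul, -Pi.smul_apply] using this
  have b1 : bil (g 1) (g 1) = 0 :=
    n1 1 5 (by ext i; fin_cases i <;> simp [cross, e]) (by decide)
  have b2 : bil (g 2) (g 2) = 0 :=
    n1 2 6 (by ext i; fin_cases i <;> simp [cross, e]) (by decide)
  have b3 : bil (g 3) (g 3) = 0 :=
    n1 3 4 (by ext i; fin_cases i <;> simp [cross, e]) (by decide)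
  have b4 : bil (g 4) (g 4) = 0 :=
    n1 4 2 (by ext i; fin_cases i <;> simp [cross, e]) (by decide)
  have b5 : bil (g 5) (g 5) = 0 :=
    n1 5 3 (by ext i; fin_cases i <;> simp [cross, e]) (by decide)
  have b6 : bil (g 6) (g 6) = 0 :=
    n1 6 1 (by ext i; fin_cases i <;> simp [cross, e]) (by decide)
  have b12 := bil_of_null_add b1 b2
    (n2 1 2 6 (by ext i; fin_cases i <;> simp [cross, e]) (by decide) (by decide))
  have b13 := bil_of_null_add b1 b3
    (n2 1 3 5 (by ext i; fin_cases i <;> simp [cross, e]) (by decide) (by decide))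
  have b23 := bil_of_null_add b2 b3
    (n2 2 3 4 (by ext i; fin_cases i <;> simp [cross, e]) (by decide) (by decide))
  have b45 := bil_of_null_add b4 b5
    (n2 4 5 3 (by ext i; fin_cases i <;> simp [cross, e]) (by decide) (by decide))
  have b46 := bil_of_null_add b4 b6
    (n2 4 6 2 (by ext i; fin_cases i <;> simp [cross, e]) (by decide) (by decide))
  have b56 := bil_of_null_add b5 b6
    (n2 5 6 1 (by ext i; fin_cases i <;> simp [cross, e]) (by decide) (by decide))
  have b15 := bil_of_null_add b1 b5
    (n2 1 5 1 (by ext i; fin_cases i <;> simp [cross, e]) (by decide) (by decide))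
  have b16 := bil_of_null_add b1 b6
    (n2 1 6 1 (by ext i; fin_cases i <;> simp [cross, e]) (by decide) (by decide))
  have b24 := bil_of_null_add b2 b4
    (n2 2 4 2 (by ext i; fin_cases i <;> simp [cross, e]) (by decide) (by decide))
  have b26 := bil_of_null_add b2 b6
    (n2 2 6 2 (by ext i; fin_cases i <;> simp [cross, e]) (by decide) (by decide))
  have b34 := bil_of_null_add b3 b4
    (n2 3 4 3 (by ext i; fin_cases i <;> simp [cross, e]) (by decide) (by decide))
  have b35 := bil_of_null_add b3 b5
    (n2 3 5 3 (by ext i; fin_cases i <;> simp [cross, e]) (by decide) (by decide))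
  -- The null vectors `e 0 + s e i + s⁻¹ e j` tie the hyperbolic pair `i`, `j` to `e 0`. For `i =
  -- 1`, `j = 4` the certificate is `e 2 + s e 6`; the other two pencils are obtained by cyclic
  -- permutation.
  obtain ⟨b01, b04, b14⟩ := bil_of_null_pencil b1 b4
    (n3 1 4 2 6 (fun s hs => by ext i; fin_cases i <;> simp [cross, e, hs])
      (by decide) (by decide) (by decide) (by decide) (by decide) (by decide) (by decide))
  obtain ⟨b02, b05, b25⟩ := bil_of_null_pencil b2 b5
    (n3 2 5 3 4 (fun s hs => by ext i; fin_cases i <;> simp [cross, e, hs])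
      (by decide) (by decide) (by decide) (by decide) (by decide) (by decide) (by decide))
  obtain ⟨b03, b06, b36⟩ := bil_of_null_pencil b3 b6
    (n3 3 6 1 5 (fun s hs => by ext i; fin_cases i <;> simp [cross, e, hs])
      (by decide) (by decide) (by decide) (by decide) (by decide) (by decide) (by decide))
  -- The factor is read off at `e 0`, which has norm 2.
  refine ⟨bil (g 0) (g 0) / 2, fun x y => ?_⟩
  rw [vecMul_eq_rows, vecMul_eq_rows]
  simp only [bil_add_left, bil_add_right, bil_smul_left, bil_smul_right]
  simp only [bil_comm (g 1) (g 0), bil_comm (g 2) (g 0), bil_comm (g 3) (g 0),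
    bil_comm (g 4) (g 0), bil_comm (g 5) (g 0), bil_comm (g 6) (g 0), bil_comm (g 2) (g 1),
    bil_comm (g 3) (g 1), bil_comm (g 4) (g 1), bil_comm (g 5) (g 1), bil_comm (g 6) (g 1),
    bil_comm (g 3) (g 2), bil_comm (g 4) (g 2), bil_comm (g 5) (g 2), bil_comm (g 6) (g 2),
    bil_comm (g 4) (g 3), bil_comm (g 5) (g 3), bil_comm (g 6) (g 3), bil_comm (g 5) (g 4),
    bil_comm (g 6) (g 4), bil_comm (g 6) (g 5), b1, b2, b3, b4, b5, b6, b01, b02, b03, b04, b05,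
    b06, b12, b13, b14, b15, b16, b23, b24, b25, b26, b34, b35, b36, b45, b46, b56]
  simp only [bil]
  ring

/-- The multiplier of an element of `G` is the cube of a scalar whose square is the multiplier of
the bilinear form. -/
lemma exists_similitude {g : Matrix (Fin 7) (Fin 7) F} (hgu : IsUnit g) {c : F}
    (hg : ∀ x y z, tri (x ᵥ* g) (y ᵥ* g) (z ᵥ* g) = c * tri x y z) :
    ∃ t : F, t ≠ 0 ∧ c = t ^ 3 ∧ ∀ x y, bil (x ᵥ* g) (y ᵥ* g) = t ^ 2 * bil x y := by
  obtain ⟨m, hm⟩ := exists_bil_vecMul hgu hg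
  obtain ⟨u, rfl⟩ := hgu
  have hz (z : Fin 7 → F) : z = (z ᵥ* (u⁻¹).1) ᵥ* u.1 := by
    rw [vecMul_vecMul, Units.inv_mul, vecMul_one]
  have hm0 : m ≠ 0 := by
    rintro rfl
    have h := hm (e F 0 ᵥ* (u⁻¹).1) (e F 0 ᵥ* (u⁻¹).1)
    rw [← hz] at h
    simp [bil, e] at h
  have h2 : IsUnit (2 : F) := isUnit_iff_ne_zero.2 two_ne_zero
  have hcr (x y : Fin 7 → F) :
      cross (x ᵥ* u.1) (y ᵥ* u.1) = (c / m) • (cross x y ᵥ* u.1) := by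
    refine eq_of_bil_eq h2 fun z => ?_
    rw [hz z, bil_cross_vecMul hg, bil_smul_left, hm]
    field_simp
  -- `cross` is multiplied by `c / m`, so comparing both sides of `cross_cross_self` for `e 0`, `e
  -- 1` before and after applying the matrix gives the square.
  have ht : (c / m) ^ 2 = m := by
    have h1 := cross_cross_self (e F 0 ᵥ* u.1) (e F 1 ᵥ* u.1)
    rw [hcr, cross_smul_right, hcr, hm, hm, cross_cross_self] at h1
    have h3 : bil (e F 0) (e F 0) = 2 := by simp [bil, e]
    have h4 : bil (e F 0) (e F 1) = 0 := by simp [bil, e]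
    rw [h3, h4] at h1
    have h5 := congrArg (fun z => (z ᵥ* (u⁻¹).1) 1) h1
    simp only [mul_zero, zero_smul, sub_zero, smul_vecMul, vecMul_vecMul, Units.mul_inv,
      vecMul_one, e, Pi.smul_apply, Pi.single_eq_same, smul_eq_mul, mul_one] at h5
    linear_combination (1 / 4 : F) * h5
  refine ⟨c / m, ?_, ?_, fun x y => by rw [hm, ht]⟩
  · intro h0
    rw [h0] at ht
    exact hm0 (by rw [← ht]; simp)
  · rw [pow_succ, ht]
    field_simp

end Similitude

/-! ### The stabiliser of a vector -/

section Stabiliser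

open Matrix

variable {R : Type*} [CommRing R]

/-- `g` multiplies the trilinear form by `t ^ 3` and the bilinear form by `t ^ 2`. -/
def IsSimilitude (t : R) (g : Matrix (Fin 7) (Fin 7) R) : Prop :=
  (∀ x y z, tri (x ᵥ* g) (y ᵥ* g) (z ᵥ* g) = t ^ 3 * tri x y z) ∧
    ∀ x y, bil (x ᵥ* g) (y ᵥ* g) = t ^ 2 * bil x y

lemma IsSimilitude.mul {s t : R} {g h : Matrix (Fin 7) (Fin 7) R} (hg : IsSimilitude s g)
    (hh : IsSimilitude t h) : IsSimilitude (s * t) (g * h) := by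
  constructor
  · intro x y z
    simp only [← vecMul_vecMul]
    rw [hh.1, hg.1]; ring
  · intro x y
    simp only [← vecMul_vecMul]
    rw [hh.2, hg.2]; ring

lemma IsSimilitude.inv {s t : R} {g h : Matrix (Fin 7) (Fin 7) R} (hg : IsSimilitude s g)
    (hst : s * t = 1) (hgh : h * g = 1) : IsSimilitude t h := by
  have hx (x : Fin 7 → R) : (x ᵥ* h) ᵥ* g = x := by rw [vecMul_vecMul, hgh, vecMul_one]
  constructor
  · intro x y z
    have h1 := hg.1 (x ᵥ* h) (y ᵥ* h) (z ᵥ* h)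
    rw [hx, hx, hx] at h1
    rw [h1, ← mul_assoc, ← mul_pow, mul_comm t, hst, one_pow, one_mul]
  · intro x y
    have h1 := hg.2 (x ᵥ* h) (y ᵥ* h)
    rw [hx, hx] at h1
    rw [h1, ← mul_assoc, ← mul_pow, mul_comm t, hst, one_pow, one_mul]

lemma one_row (i : Fin 7) : (1 : Matrix (Fin 7) (Fin 7) R) i = e R i := by
  ext j
  simp [e, Pi.single_apply, Matrix.one_apply, eq_comm]

lemma bil_vecMul_iff (g : Matrix (Fin 7) (Fin 7) R) (m : R) :
    (∀ x y, bil (x ᵥ* g) (y ᵥ* g) = m * bil x y) ↔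
      ∀ i j, bil (g i) (g j) = m * bil (e R i) (e R j) := by
  constructor
  · intro h i j
    simpa [e, Matrix.row] using h (e R i) (e R j)
  · intro h x y
    have hx (x : Fin 7 → R) := vecMul_eq_rows x 1
    simp only [vecMul_one, one_row] at hx
    conv_rhs => rw [hx x, hx y]
    rw [vecMul_eq_rows, vecMul_eq_rows]
    simp only [bil_add_left, bil_add_right, bil_smul_left, bil_smul_right, h]
    ring

/-- Only equations in the matrix entries remain, so the property passes along ring maps and descends
along injective ones. -/
lemma isSimilitude_iff (t : R) (g : Matrix (Fin 7) (Fin 7) R) : IsSimilitude t g ↔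
    (∀ r, StrictMono r → coordw g r = t ^ 3 * coordw 1 r) ∧
      ∀ i j, bil (g i) (g j) = t ^ 2 * bil (e R i) (e R j) := by
  rw [IsSimilitude, ← act3_iff_tri, act_iff, bil_vecMul_iff]

lemma e_map {S : Type*} [CommRing S] (f : R →+* S) (i : Fin 7) : f ∘ e R i = e S i := by
  ext j
  by_cases h : j = i <;> simp [e, h]

lemma isSimilitude_map_iff {S : Type*} [CommRing S] {f : R →+* S} (hf : Function.Injective f)
    (t : R) (g : Matrix (Fin 7) (Fin 7) R) : IsSimilitude (f t) (g.map f) ↔ IsSimilitude t g := by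
  rw [isSimilitude_iff, isSimilitude_iff]
  refine and_congr (forall₂_congr fun r _ => ?_) (forall₂_congr fun i j => ?_)
  · rw [coordw_map, coordw_one_map f, ← map_pow, ← map_mul, hf.eq_iff]
  · have h (i : Fin 7) : g.map f i = f ∘ g i := rfl
    rw [h, h, bil_map, ← e_map f, ← e_map f, bil_map, ← map_pow, ← map_mul, hf.eq_iff]

lemma IsSimilitude.map {S : Type*} [CommRing S] (f : R →+* S) {t : R}
    {g : Matrix (Fin 7) (Fin 7) R} (hg : IsSimilitude t g) : IsSimilitude (f t) (g.map f) := by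
  rw [isSimilitude_iff] at hg ⊢
  refine ⟨fun r hr => ?_, fun i j => ?_⟩
  · rw [coordw_map, coordw_one_map f, ← map_pow, ← map_mul, hg.1 r hr]
  · have h (i : Fin 7) : g.map f i = f ∘ g i := rfl
    rw [h, h, bil_map, ← e_map f, ← e_map f, bil_map, ← map_pow, ← map_mul, hg.2]

lemma IsSimilitude.mem_G {t : R} {g : GL (Fin 7) R} (hg : IsSimilitude t g.1) : g ∈ G R :=
  mem_of_act g (t ^ 3) ((act3_iff_tri _ _).2 hg.1)

lemma blk_vecMul (A B : Matrix (Fin 3) (Fin 3) R) (x : Fin 7 → R) : x ᵥ* blk A B =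
    ![x 0, x 1 * A 0 0 + x 2 * A 1 0 + x 3 * A 2 0, x 1 * A 0 1 + x 2 * A 1 1 + x 3 * A 2 1,
      x 1 * A 0 2 + x 2 * A 1 2 + x 3 * A 2 2, x 4 * B 0 0 + x 5 * B 1 0 + x 6 * B 2 0,
      x 4 * B 0 1 + x 5 * B 1 1 + x 6 * B 2 1, x 4 * B 0 2 + x 5 * B 1 2 + x 6 * B 2 2] := by
  rw [blk_eq, vecMul_eq_rows]
  ext i
  fin_cases i <;> simp

/-- The elements of `SL(3) ⊂ G` are isometries. -/
lemma isSimilitude_d (A : SpecialLinearGroup (Fin 3) R) : IsSimilitude 1 (d R A).1.1 := by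
  constructor
  · rw [one_pow, ← act3_iff_tri]
    refine blk_act _ _ A.2 ?_ ?_
    · rw [det_transpose]
      exact (A⁻¹).2
    · rw [transpose_transpose]
      exact congrArg Subtype.val (mul_inv_cancel A)
  · intro x y
    have h : A.1 * (A⁻¹).1 = 1 := congrArg Subtype.val (mul_inv_cancel A)
    have h' (i j : Fin 3) := congrFun (congrFun h i) j
    simp only [mul_apply, Fin.sum_univ_three] at h'
    have h00 := h' 0 0
    have h01 := h' 0 1
    have h02 := h' 0 2
    have h10 := h' 1 0
    have h11 := h' 1 1
    have h12 := h' 1 2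
    have h20 := h' 2 0
    have h21 := h' 2 1
    have h22 := h' 2 2
    simp only [one_apply_eq, ne_eq, Fin.reduceEq, not_false_eq_true, one_apply_ne]
      at h00 h01 h02 h10 h11 h12 h20 h21 h22
    rw [d_coe, blk_vecMul, blk_vecMul]
    simp only [bil, transpose_apply]
    simp only [cons_val]
    linear_combination
      -(x 1 * y 4 + y 1 * x 4) * h00 - (x 1 * y 5 + y 1 * x 5) * h01 -
      (x 1 * y 6 + y 1 * x 6) * h02 - (x 2 * y 4 + y 2 * x 4) * h10 -
      (x 2 * y 5 + y 2 * x 5) * h11 - (x 2 * y 6 + y 2 * x 6) * h12 -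
      (x 3 * y 4 + y 3 * x 4) * h20 - (x 3 * y 5 + y 3 * x 5) * h21 -
      (x 3 * y 6 + y 3 * x 6) * h22

/-- An isometry in `G` that fixes `e₁` lies in `SL(3)`. -/
lemma exists_eq_d (h2 : IsUnit (2 : R)) {Y : G R} (hY : IsSimilitude 1 Y.1.1)
    (h0 : e R 0 ᵥ* Y.1.1 = e R 0) : ∃ A, d R A = Y := by
  -- `Y` commutes with `cross (e R 0)`, whose eigenvalues are `0`, `-2` (on `e 1`, `e 2`, `e 3`) and
  -- `2` (on `e 4`, `e 5`, `e 6`). As their differences are units, `Y` is block diagonal.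
  have hcr (j : Fin 7) := cross_vecMul h2 Y.1.isUnit hY.1 hY.2 (e R 0) (e R j)
  rw [h0] at hcr
  have hrow (j : Fin 7) : e R j ᵥ* Y.1.1 = Y.1.1 j := by simp [e, Matrix.row]
  have hcross (y : Fin 7 → R) : cross (e R 0) y =
      ![0, -2 * y 1, -2 * y 2, -2 * y 3, 2 * y 4, 2 * y 5, 2 * y 6] := by
    ext i
    fin_cases i <;> simp [cross, e]
  have hL (j : Fin 7) (hj : j = 1 ∨ j = 2 ∨ j = 3) : cross (e R 0) (e R j) = (-2 : R) • e R j := by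
    rw [hcross]
    rcases hj with rfl | rfl | rfl <;> ext i <;> fin_cases i <;> simp [e]
  have hM (j : Fin 7) (hj : j = 4 ∨ j = 5 ∨ j = 6) : cross (e R 0) (e R j) = (2 : R) • e R j := by
    rw [hcross]
    rcases hj with rfl | rfl | rfl <;> ext i <;> fin_cases i <;> simp [e]
  have c2 {x : R} (h : 2 * x = 0) : x = 0 := h2.mul_left_cancel (by rw [h, mul_zero])
  have hLY (j : Fin 7) (hj : j = 1 ∨ j = 2 ∨ j = 3) :
      Y.1.1 j 0 = 0 ∧ Y.1.1 j 4 = 0 ∧ Y.1.1 j 5 = 0 ∧ Y.1.1 j 6 = 0 := by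
    have h := hcr j
    rw [hL j hj, smul_vecMul, hrow, hcross, one_smul] at h
    have h0 := congrFun h 0
    have h4 := congrFun h 4
    have h5 := congrFun h 5
    have h6 := congrFun h 6
    simp only [cons_val, Pi.smul_apply, smul_eq_mul] at h0 h4 h5 h6
    refine ⟨c2 ?_, c2 (c2 ?_), c2 (c2 ?_), c2 (c2 ?_)⟩
    · linear_combination h0
    · linear_combination h4
    · linear_combination h5
    · linear_combination h6
  have hMY (j : Fin 7) (hj : j = 4 ∨ j = 5 ∨ j = 6) :
      Y.1.1 j 0 = 0 ∧ Y.1.1 j 1 = 0 ∧ Y.1.1 j 2 = 0 ∧ Y.1.1 j 3 = 0 := by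
    have h := hcr j
    rw [hM j hj, smul_vecMul, hrow, hcross, one_smul] at h
    have h0 := congrFun h 0
    have h4 := congrFun h 1
    have h5 := congrFun h 2
    have h6 := congrFun h 3
    simp only [cons_val, Pi.smul_apply, smul_eq_mul] at h0 h4 h5 h6
    refine ⟨c2 ?_, c2 (c2 ?_), c2 (c2 ?_), c2 (c2 ?_)⟩
    · linear_combination -h0
    · linear_combination -h4
    · linear_combination -h5
    · linear_combination -h6
  let A : Matrix (Fin 3) (Fin 3) R :=
    !![Y.1.1 1 1, Y.1.1 1 2, Y.1.1 1 3; Y.1.1 2 1, Y.1.1 2 2, Y.1.1 2 3;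
      Y.1.1 3 1, Y.1.1 3 2, Y.1.1 3 3]
  let D : Matrix (Fin 3) (Fin 3) R :=
    !![Y.1.1 4 4, Y.1.1 4 5, Y.1.1 4 6; Y.1.1 5 4, Y.1.1 5 5, Y.1.1 5 6;
      Y.1.1 6 4, Y.1.1 6 5, Y.1.1 6 6]
  obtain ⟨a10, a14, a15, a16⟩ := hLY 1 (by decide)
  obtain ⟨a20, a24, a25, a26⟩ := hLY 2 (by decide)
  obtain ⟨a30, a34, a35, a36⟩ := hLY 3 (by decide)
  obtain ⟨a40, a41, a42, a43⟩ := hMY 4 (by decide)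
  obtain ⟨a50, a51, a52, a53⟩ := hMY 5 (by decide)
  obtain ⟨a60, a61, a62, a63⟩ := hMY 6 (by decide)
  have hY0 (j : Fin 7) : Y.1.1 0 j = e R 0 j := by rw [← hrow 0, h0]
  have hYb : Y.1.1 = blk A D := by
    rw [blk_eq]
    ext i j
    fin_cases i
    · rw [show ((fun i => i) (⟨0, by decide⟩ : Fin 7)) = 0 from rfl, hY0]
      fin_cases j <;> simp [e]
    · fin_cases j
      exacts [a10, rfl, rfl, rfl, a14, a15, a16]
    · fin_cases j
      exacts [a20, rfl, rfl, rfl, a24, a25, a26]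
    · fin_cases j
      exacts [a30, rfl, rfl, rfl, a34, a35, a36]
    · fin_cases j
      exacts [a40, a41, a42, a43, rfl, rfl, rfl]
    · fin_cases j
      exacts [a50, a51, a52, a53, rfl, rfl, rfl]
    · fin_cases j
      exacts [a60, a61, a62, a63, rfl, rfl, rfl]
  -- Evaluating `tri` on `e 1`, `e 2`, `e 3` gives the determinant; the pairing of the two
  -- 3-dimensional blocks under `bil` then forces `D` to be the inverse transpose of `A`.
  have hdet : A.det = 1 := by
    have h := hY.1 (e R 1) (e R 2) (e R 3)
    rw [hYb, blk_vecMul, blk_vecMul, blk_vecMul] at h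
    rw [det_fin_three]
    simp [tri, e] at h
    linear_combination h
  have hAD : A * D.transpose = 1 := by
    have h (i j : Fin 7) := hY.2 (e R i) (e R j)
    rw [hYb] at h
    simp only [blk_vecMul, bil, e, one_pow, one_mul] at h
    ext i j
    rw [mul_apply, Fin.sum_univ_three]
    have h' := h ⟨i.1 + 1, by omega⟩ ⟨j.1 + 4, by omega⟩
    fin_cases i <;> fin_cases j <;> simp at h' ⊢ <;> linear_combination -h'
  obtain ⟨A', hA'⟩ : ∃ A' : SpecialLinearGroup (Fin 3) R, A'.1 = A := ⟨⟨A, hdet⟩, rfl⟩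
  refine ⟨A', Subtype.ext (Units.ext ?_)⟩
  have hinv : (A'⁻¹).1 * A = 1 := by
    rw [← hA']
    exact congrArg Subtype.val (inv_mul_cancel A')
  rw [d_coe, hYb, hA', ← transpose_transpose D, ← one_mul D.transpose, ← hinv, mul_assoc, hAD,
    mul_one]

end Stabiliser

/-! ### `SU_α(2,1)` as a stabiliser -/

section Unitary

open Matrix

variable {k K : Type*} [Field k] [CharZero k] [Field K] [Algebra k K]

/-- The row vector over `k` fixed by the image of `SU_α(2,1)`, where `a = α⁻²`. -/
def fixedRow (a : k) : Fin 7 → k := ![0, a, 0, 0, -1, 0, 0]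

lemma isSimilitude_gMat {F : Type*} [Field F] (h2 : (2 : F) ≠ 0) (α : F) :
    IsSimilitude α (gMat α) := by
  refine ⟨(act3_iff_tri _ _).1 (gMat_act h2 α), fun x y => ?_⟩
  rw [vecMul_eq_rows, vecMul_eq_rows]
  simp [gMat, bil]
  field_simp
  ring

lemma isSimilitude_gT {α : K} (hα : α ∉ Set.range (algebraMap k K)) (R : Type*) [CommRing R]
    [Algebra k R] : IsSimilitude (incR k K R α) (gT hα R).1.1 :=
  (isSimilitude_gMat (two_ne k K) α).map (incR k K R)

lemma isSimilitude_gT_inv {α : K} (hα : α ∉ Set.range (algebraMap k K)) (R : Type*) [CommRing R]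
    [Algebra k R] : IsSimilitude (incR k K R α⁻¹) ((gT hα R)⁻¹).1.1 := by
  refine (isSimilitude_gT hα R).inv ?_ ?_
  · rw [← map_mul, mul_inv_cancel₀ (ne_zero_of_notMem hα), map_one]
  · exact congrArg (fun g : G (R ⊗[k] K) => g.1.1) (inv_mul_cancel (gT hα R))

lemma coe_mul_G {R : Type*} [CommRing R] (g h : G R) : (g * h).1.1 = g.1.1 * h.1.1 := rfl

lemma coe_inv_mul_G {R : Type*} [CommRing R] (g : G R) : (g⁻¹).1.1 * g.1.1 = 1 :=
  congrArg (fun g : G R => g.1.1) (inv_mul_cancel g)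

lemma coe_mul_inv_G {R : Type*} [CommRing R] (g : G R) : g.1.1 * (g⁻¹).1.1 = 1 :=
  congrArg (fun g : G R => g.1.1) (mul_inv_cancel g)

lemma vecMul_map {R S : Type*} [CommRing R] [CommRing S] (f : R →+* S) (x : Fin 7 → R)
    (g : Matrix (Fin 7) (Fin 7) R) : (f ∘ x) ᵥ* g.map f = f ∘ (x ᵥ* g) := by
  ext i
  simp [vecMul, dotProduct]

-- The vector `fixedRow a` becomes the first row of `g_α⁻¹`; this row involves only `α²`, hence is
-- defined over `k`.
omit [CharZero k] in
lemma fixedRow_vecMul_gMat {α : K} (h2 : (2 : K) ≠ 0) {a : k}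
    (ha : algebraMap k K a * α ^ 2 = 1) : (algebraMap k K ∘ fixedRow a) ᵥ* gMat α = e K 0 := by
  rw [vecMul_eq_rows]
  ext i
  fin_cases i <;> simp [gMat, fixedRow, e, Algebra.smul_def] <;> field_simp <;>
    linear_combination ha

omit [CharZero k] in
lemma incR_algebraMap (R : Type*) [CommRing R] [Algebra k R] (x : k) :
    incR k K R (algebraMap k K x) = incL k K R (algebraMap k R x) := by
  simp only [incR, incL]
  change (1 : R) ⊗ₜ[k] (algebraMap k K x) = (algebraMap k R x) ⊗ₜ[k] (1 : K)
  rw [Algebra.algebraMap_eq_smul_one, Algebra.algebraMap_eq_smul_one, TensorProduct.tmul_smul,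
    TensorProduct.smul_tmul']

lemma fixedRow_vecMul_gT {α : K} (hα : α ∉ Set.range (algebraMap k K)) {a : k}
    (ha : algebraMap k K a * α ^ 2 = 1) (R : Type*) [CommRing R] [Algebra k R] :
    (incL k K R ∘ algebraMap k R ∘ fixedRow a) ᵥ* (gT hα R).1.1 = e _ 0 := by
  have h := congrArg (fun x => incR k K R ∘ x)
    (fixedRow_vecMul_gMat (two_ne k K) ha)
  simp only [← vecMul_map, e_map] at h
  rw [← h, gT_coe]
  congr 1
  ext i
  exact (incR_algebraMap R _).symm

variable (hK : Module.finrank k K = 2) {α : K} (hα : α ∉ Set.range (algebraMap k K))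
  (hα2 : α ^ 2 ∈ Set.range (algebraMap k K)) {σ : K ≃ₐ[k] K} (hσ : σ ≠ 1) (R : Type*) [CommRing R]
  [Algebra k R]

lemma emb_injective : Function.Injective (emb hK hα hα2 hσ R) := by
  intro A B h
  have h1 := emb_spec hK hα hα2 hσ R A
  rw [h, emb_spec] at h1
  have h2 : d (R ⊗[k] K) A.1 = d _ B.1 := (mul_left_cancel (mul_right_cancel h1)).symm
  have h3 := congrArg (fun g : G (R ⊗[k] K) => g.1.1) h2
  simp only [d_coe, blk_eq] at h3
  refine SU.ext' fun i j => ?_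
  -- The shift by one skips the trivial 1×1 block.
  have h4 := congrFun (congrFun h3 ⟨i.1 + 1, by omega⟩) ⟨j.1 + 1, by omega⟩
  fin_cases i <;> fin_cases j <;> exact h4

lemma isSimilitude_emb (A : SU σ R) : IsSimilitude 1 (emb hK hα hα2 hσ R A).1.1 := by
  rw [← isSimilitude_map_iff (incL_injective k K R), map_one]
  have h : (emb hK hα hα2 hσ R A).1.1.map (incL k K R) =
      (gT hα R).1.1 * (d _ A.1).1.1 * ((gT hα R)⁻¹).1.1 :=
    congrArg (fun g : G (R ⊗[k] K) => g.1.1) (emb_spec hK hα hα2 hσ R A)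
  rw [h]
  have := ((isSimilitude_gT hα R).mul (isSimilitude_d A.1)).mul (isSimilitude_gT_inv hα R)
  rwa [mul_one, ← map_mul, mul_inv_cancel₀ (ne_zero_of_notMem hα), map_one] at this

lemma fixedRow_vecMul_emb {a : k} (ha : algebraMap k K a * α ^ 2 = 1) (A : SU σ R) :
    (algebraMap k R ∘ fixedRow a) ᵥ* (emb hK hα hα2 hσ R A).1.1 = algebraMap k R ∘ fixedRow a := by
  apply (incL_injective k K R).comp_left
  change incL k K R ∘ _ = incL k K R ∘ _
  have h : (emb hK hα hα2 hσ R A).1.1.map (incL k K R) =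
      (gT hα R).1.1 * (d _ A.1).1.1 * ((gT hα R)⁻¹).1.1 :=
    congrArg (fun g : G (R ⊗[k] K) => g.1.1) (emb_spec hK hα hα2 hσ R A)
  have h0 : e (R ⊗[k] K) 0 ᵥ* (d _ A.1).1.1 = e _ 0 := by
    rw [d_coe, blk_vecMul]
    ext i
    fin_cases i <;> simp [e]
  rw [← vecMul_map, h, ← vecMul_vecMul, ← vecMul_vecMul, fixedRow_vecMul_gT hα ha, h0,
    ← fixedRow_vecMul_gT hα ha, vecMul_vecMul, coe_mul_inv_G, vecMul_one]

omit [CharZero k] in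
lemma mem_SU_of_conj {B : SpecialLinearGroup (Fin 3) (R ⊗[k] K)}
    (h : B.1.map (conj σ R) = Lam _ * (B⁻¹).1.transpose * Lam _) : B ∈ SU σ R := by
  change B.1 * Lam _ * (B.1.map (conj σ R)).transpose = Lam _
  have h1 : B.1 * (B⁻¹).1 = 1 := congrArg Subtype.val (mul_inv_cancel B)
  rw [h, transpose_mul, transpose_mul, transpose_transpose, Lam_transpose]
  calc B.1 * Lam _ * (Lam _ * ((B⁻¹).1 * Lam _))
      = B.1 * (Lam _ * Lam _) * (B⁻¹).1 * Lam _ := by simp only [mul_assoc]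
    _ = _ := by rw [Lam_mul_Lam, mul_one, h1, one_mul]

/-- The image of `SU_α(2,1)` consists of the isometries in `G` that fix `fixedRow`. -/
lemma exists_emb_eq {a : k} (ha : algebraMap k K a * α ^ 2 = 1) {X : G R}
    (hX : IsSimilitude 1 X.1.1)
    (hv : (algebraMap k R ∘ fixedRow a) ᵥ* X.1.1 = algebraMap k R ∘ fixedRow a) :
    ∃ A, emb hK hα hα2 hσ R A = X := by
  have hα0 := ne_zero_of_notMem hα
  set Xt := G.map (incL k K R) X with hXt
  have hYs : IsSimilitude 1 ((gT hα R)⁻¹ * Xt * gT hα R).1.1 := by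
    have h1 : IsSimilitude 1 Xt.1.1 := by
      have := hX.map (incL k K R)
      rwa [map_one] at this
    have := ((isSimilitude_gT_inv hα R).mul h1).mul (isSimilitude_gT hα R)
    rwa [mul_one, ← map_mul, inv_mul_cancel₀ hα0, map_one] at this
  have hv' : (incL k K R ∘ algebraMap k R ∘ fixedRow a) ᵥ* Xt.1.1 =
      incL k K R ∘ algebraMap k R ∘ fixedRow a := by
    conv_rhs => rw [← hv, ← vecMul_map]
    rfl
  have hY0 : e _ 0 ᵥ* ((gT hα R)⁻¹ * Xt * gT hα R).1.1 = e _ 0 := by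
    rw [coe_mul_G, coe_mul_G, ← vecMul_vecMul, ← vecMul_vecMul]
    conv_lhs => rw [← fixedRow_vecMul_gT hα ha R, vecMul_vecMul _ (gT hα R).1.1, coe_mul_inv_G,
      vecMul_one, hv', fixedRow_vecMul_gT hα ha]
  have h2 : IsUnit (2 : R ⊗[k] K) := by
    have h : IsUnit (incR k K R 2) := (isUnit_iff_ne_zero.2 (two_ne k K)).map (incR k K R)
    rwa [map_ofNat] at h
  obtain ⟨B, hB⟩ := exists_eq_d h2 hYs hY0
  have hXB : Xt = gT hα R * d _ B * (gT hα R)⁻¹ := by rw [hB]; group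
  have hfix : G.map (conj σ R : R ⊗[k] K →+* R ⊗[k] K) Xt = Xt := by
    refine G.ext' fun i j => ?_
    simp only [hXt, G.map_apply]
    change conj σ R (X.1.1 i j ⊗ₜ[k] (1 : K)) = X.1.1 i j ⊗ₜ[k] (1 : K)
    simp [conj]
  have hg : (G.map (conj σ R : R ⊗[k] K →+* R ⊗[k] K) (gT hα R)).1.1 = (gT hα R).1.1 * tau _ :=
    gT_conj hK hα hα2 hσ R
  have hmul : Xt * gT hα R = gT hα R * d _ B := by rw [hXB]; group
  -- Applying `σ` to `X g_α = g_α d(B)`, with `X` fixed and `g_α` sent to `g_α τ`, shows that `σ`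
  -- acts on `d(B)` as conjugation by `τ`. Its first 3×3 block is the unitary condition.
  have key := congrArg (fun g => (G.map (conj σ R : R ⊗[k] K →+* R ⊗[k] K) g).1.1) hmul
  simp only [map_mul, hfix, coe_mul_G, hg] at key
  rw [← mul_assoc, ← coe_mul_G, hmul, coe_mul_G, mul_assoc, mul_assoc] at key
  have key2 := congrArg (fun M => ((gT hα R)⁻¹).1.1 * M) key
  simp only [← mul_assoc, coe_inv_mul_G, one_mul] at key2
  have hd : (G.map (conj σ R : R ⊗[k] K →+* R ⊗[k] K) (d _ B)).1.1 =
      blk (B.1.map (conj σ R)) ((B⁻¹).1.transpose.map (conj σ R)) := by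
    change (blk B.1 (B⁻¹).1.transpose).map (conj σ R : R ⊗[k] K →+* R ⊗[k] K) = _
    rw [blk_map]
    rfl
  rw [hd, d_coe] at key2
  have key3 : blk (B.1.map (conj σ R)) ((B⁻¹).1.transpose.map (conj σ R)) =
      blk (Lam _ * (B⁻¹).1.transpose * Lam _) (Lam _ * B.1 * Lam _) := by
    have ht : tau (R ⊗[k] K) * tau _ = 1 := by
      simp only [tau, block_mul, mul_zero, zero_mul, zero_add, add_zero, Lam_mul_Lam, block_one]
    rw [← tau_mul_blk] at key2
    have := congrArg (fun M => tau (R ⊗[k] K) * M) key2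
    simpa only [← mul_assoc, ht, one_mul] using this.symm
  have hB1 : B.1.map (conj σ R) = Lam _ * (B⁻¹).1.transpose * Lam _ := by
    rw [blk_eq, blk_eq] at key3
    ext i j
    have h4 := congrFun (congrFun key3 ⟨i.1 + 1, by omega⟩) ⟨j.1 + 1, by omega⟩
    fin_cases i <;> fin_cases j <;> exact h4
  refine ⟨⟨B, mem_SU_of_conj R hB1⟩, G.map_injective (incL_injective k K R) ?_⟩
  rw [emb_spec, ← hXt, hXB]

end Unitary

/-! ### Galois descent and transitivity on vectors of given norm -/

section Descent

open Matrix Module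

variable {k L : Type*} [Field k] [Field L] [Algebra k L]

/-- A smooth semilinear action of `Gal(L/k)` on `L⁷` that is compatible with the trilinear and the
bilinear form. -/
structure IsTwistedAction (ρ : (L ≃ₐ[k] L) → (Fin 7 → L) → Fin 7 → L) : Prop where
  one : ∀ x, ρ 1 x = x
  mul : ∀ a b x, ρ (a * b) x = ρ a (ρ b x)
  add : ∀ a x y, ρ a (x + y) = ρ a x + ρ a y
  smul : ∀ a (r : L) x, ρ a (r • x) = a r • ρ a x
  smooth : ∀ x, ∃ E : IntermediateField k L, FiniteDimensional k E ∧
    ∀ a ∈ E.fixingSubgroup, ρ a x = x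
  map_tri : ∀ a x y z, tri (ρ a x) (ρ a y) (ρ a z) = a (tri x y z)
  map_bil : ∀ a x y, bil (ρ a x) (ρ a y) = a (bil x y)

variable {ρ : (L ≃ₐ[k] L) → (Fin 7 → L) → Fin 7 → L}

lemma IsTwistedAction.zero (hρ : IsTwistedAction ρ) (a : L ≃ₐ[k] L) : ρ a 0 = 0 := by
  simpa using hρ.smul a 0 0

lemma IsTwistedAction.sum (hρ : IsTwistedAction ρ) (a : L ≃ₐ[k] L) {ι : Type*} (s : Finset ι)
    (f : ι → Fin 7 → L) : ρ a (∑ i ∈ s, f i) = ∑ i ∈ s, ρ a (f i) :=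
  map_sum (⟨⟨ρ a, hρ.zero a⟩, hρ.add a⟩ : (Fin 7 → L) →+ Fin 7 → L) f s

/-- A stable subspace is spanned by its fixed vectors. -/
lemma IsTwistedAction.mem_span_fixed [Normal k L] (hρ : IsTwistedAction ρ)
    (U : Submodule L (Fin 7 → L)) (hU : ∀ a, ∀ x ∈ U, ρ a x ∈ U) {x : Fin 7 → L} (hx : x ∈ U) :
    x ∈ Submodule.span L {y | y ∈ U ∧ ∀ a, ρ a y = y} := by
  classical
  obtain ⟨E, hE, hEx⟩ := hρ.smooth x
  have hlift (f : E →ₐ[k] L) : ∃ a : L ≃ₐ[k] L, ∀ y : E, a y = f y :=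
    ⟨AlgEquiv.ofBijective (f.liftNormal L) (AlgHom.normal_bijective k L L _),
      fun y => f.liftNormal_commutes L y⟩
  choose lift hl using hlift
  -- The vector `ρ a x` depends only on the restriction of `a` to `E`.
  have key (a : L ≃ₐ[k] L) (f : E →ₐ[k] L) (h : ∀ y : E, a y = f y) : ρ a x = ρ (lift f) x := by
    have h1 : (lift f)⁻¹ * a ∈ E.fixingSubgroup := by
      rw [IntermediateField.mem_fixingSubgroup_iff]
      intro y hy
      have h2 : a y = lift f y := (h ⟨y, hy⟩).trans (hl f ⟨y, hy⟩).symm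
      rw [AlgEquiv.mul_apply, h2, ← AlgEquiv.mul_apply, inv_mul_cancel, AlgEquiv.one_apply]
    conv_rhs => rw [← hEx _ h1, ← hρ.mul, mul_inv_cancel_left]
  -- These trace-like sums are fixed because composing with `a` permutes the embeddings of `E`.
  have hfix (l : E) (a : L ≃ₐ[k] L) :
      ρ a (∑ f : E →ₐ[k] L, f l • ρ (lift f) x) = ∑ f : E →ₐ[k] L, f l • ρ (lift f) x := by
    let φ : (E →ₐ[k] L) ≃ (E →ₐ[k] L) :=
      { toFun := fun f => (a : L →ₐ[k] L).comp f
        invFun := fun f => ((a⁻¹ : L ≃ₐ[k] L) : L →ₐ[k] L).comp f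
        left_inv := fun f => AlgHom.ext fun y => a.symm_apply_apply _
        right_inv := fun f => AlgHom.ext fun y => a.apply_symm_apply _ }
    rw [hρ.sum, ← Equiv.sum_comp φ (fun f : E →ₐ[k] L => f l • ρ (lift f) x)]
    refine Finset.sum_congr rfl fun f _ => ?_
    rw [hρ.smul, ← hρ.mul, key (a * lift f) (φ f)]
    · rfl
    · intro y
      rw [AlgEquiv.mul_apply, hl]
      rfl
  by_contra hxs
  obtain ⟨φ, hφx, hφ⟩ := Submodule.exists_le_ker_of_notMem hxs
  -- A functional killing every fixed vector in `U` gives a linear relation between the embeddings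
  -- of `E`. By Dedekind's independence its coefficient at the inclusion, `φ x`, is zero.
  have hli := Fintype.linearIndependent_iff.1 (linearIndependent_toLinearMap k E L)
    (fun f => φ (ρ (lift f) x)) (by
      ext l
      have h1 : ∑ f : E →ₐ[k] L, f l • ρ (lift f) x ∈
          Submodule.span L {y | y ∈ U ∧ ∀ a, ρ a y = y} :=
        Submodule.subset_span ⟨Submodule.sum_mem _ fun f _ => U.smul_mem _ (hU _ _ hx), hfix l⟩
      have h2 := hφ h1
      simpa [LinearMap.mem_ker, map_sum, mul_comm] using h2) E.val
  rw [← key 1 E.val fun _ => rfl, hρ.one] at hli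
  exact hφx hli

/-- The vectors orthogonal to three given vectors. -/
def perp (p : Fin 3 → Fin 7 → L) : Submodule L (Fin 7 → L) where
  carrier := {x | ∀ i, bil (p i) x = 0}
  add_mem' := fun hx hy i => by rw [bil_add_right, hx, hy, add_zero]
  zero_mem' := fun i => by simp [bil]
  smul_mem' := fun r x hx i => by rw [bil_smul_right, hx, mul_zero]

/-- `bil` as a linear map to the dual space. -/
def bilDual : (Fin 7 → L) →ₗ[L] Module.Dual L (Fin 7 → L) :=
  LinearMap.mk₂ L bil bil_add_left bil_smul_left bil_add_right bil_smul_right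

lemma four_le_finrank_perp (p : Fin 3 → Fin 7 → L) : 4 ≤ finrank L (perp p) := by
  have h : perp p = LinearMap.ker (LinearMap.pi fun i => bilDual (p i)) := by
    ext x
    simp [perp, bilDual, funext_iff]
  have h1 := LinearMap.finrank_range_add_finrank_ker (LinearMap.pi fun i => bilDual (p i))
  have h2 := Submodule.finrank_le (LinearMap.range (LinearMap.pi fun i => bilDual (p i)))
  rw [h]
  simp only [finrank_fin_fun] at h1 h2
  omega

/-- The non-degenerate form embeds `U` into its own annihilator, of dimension `7 - dim U`. -/
lemma finrank_le_three_of_isotropic [CharZero L] {U : Submodule L (Fin 7 → L)}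
    (hU : ∀ x ∈ U, ∀ y ∈ U, bil x y = 0) : finrank L U ≤ 3 := by
  have h1 := Subspace.finrank_add_finrank_dualAnnihilator_eq U
  have h2 : finrank L U ≤ finrank L U.dualAnnihilator := by
    refine LinearMap.finrank_le_finrank_of_injective (f := ((bilDual (L := L)).comp
      U.subtype).codRestrict U.dualAnnihilator fun x => ?_) fun x y h => ?_
    · rw [Submodule.mem_dualAnnihilator]
      exact fun y hy => hU x x.2 y hy
    · refine Subtype.ext (eq_of_bil_eq (isUnit_iff_ne_zero.2 two_ne_zero) fun z => ?_)
      exact congrArg (fun f => f.1 z) h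
  rw [finrank_fin_fun] at h1
  omega

/-- If every fixed vector of `perp p` were null, then by polarisation the fixed vectors would be
mutually orthogonal. As they span `perp p`, a space of dimension at least 4 would be totally
isotropic. -/
lemma IsTwistedAction.exists_fixed_perp [Normal k L] [CharZero L] (hρ : IsTwistedAction ρ)
    (p : Fin 3 → Fin 7 → L) (hp : ∀ i a, ρ a (p i) = p i) :
    ∃ b, (∀ i, bil (p i) b = 0) ∧ (∀ a, ρ a b = b) ∧ bil b b ≠ 0 := by
  by_contra! hcon
  have hstab : ∀ a, ∀ x ∈ perp p, ρ a x ∈ perp p := by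
    intro a x hx i
    rw [← hp i a, hρ.map_bil, hx i, map_zero]
  have hpol : ∀ x ∈ {y | y ∈ perp p ∧ ∀ a, ρ a y = y}, ∀ y ∈ {y | y ∈ perp p ∧ ∀ a, ρ a y = y},
      bil x y = 0 := by
    rintro x ⟨hx, hxf⟩ y ⟨hy, hyf⟩
    refine bil_of_null_add (hcon x hx hxf) (hcon y hy hyf)
      (hcon (x + y) ((perp p).add_mem hx hy) fun a => ?_)
    rw [hρ.add, hxf, hyf]
  have hiso : ∀ x ∈ perp p, ∀ y ∈ perp p, bil x y = 0 := by
    intro x hx y hy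
    have hx' := hρ.mem_span_fixed _ hstab hx
    have hy' := hρ.mem_span_fixed _ hstab hy
    clear hx hy
    induction hx' using Submodule.span_induction with
    | zero => simp [bil]
    | add x x' _ _ h h' => rw [bil_add_left, h, h', add_zero]
    | smul r x _ h => rw [bil_smul_left, h, mul_zero]
    | mem x hx =>
      induction hy' using Submodule.span_induction with
      | zero => simp [bil]
      | add y y' _ _ h h' => rw [bil_add_right, h, h', add_zero]
      | smul r y _ h => rw [bil_smul_right, h, mul_zero]
      | mem y hy => exact hpol x hx y hy
  have h1 := four_le_finrank_perp p
  have h2 := finrank_le_three_of_isotropic hiso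
  omega

/-- `v` is mapped to `u` by an isometry in `G` that commutes with the twisted action. -/
def Movable (ρ : (L ≃ₐ[k] L) → (Fin 7 → L) → Fin 7 → L) (v u : Fin 7 → L) : Prop :=
  ∃ M : GL (Fin 7) L, IsSimilitude 1 M.1 ∧ v ᵥ* M.1 = u ∧
    ∀ a x, ρ a (x ᵥ* M.1) = ρ a x ᵥ* M.1

lemma Movable.trans {u v w : Fin 7 → L} (h : Movable ρ u v) (h' : Movable ρ v w) :
    Movable ρ u w := by
  obtain ⟨M, hM, hu, hc⟩ := h
  obtain ⟨N, hN, hv, hc'⟩ := h'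
  refine ⟨M * N, ?_, ?_, fun a x => ?_⟩
  · simpa using hM.mul hN
  · rw [Units.val_mul, ← vecMul_vecMul, hu, hv]
  · rw [Units.val_mul, ← vecMul_vecMul, hc', hc, vecMul_vecMul]

lemma IsTwistedAction.map_cross [CharZero L] (hρ : IsTwistedAction ρ) (a : L ≃ₐ[k] L)
    (x y : Fin 7 → L) : cross (ρ a x) (ρ a y) = ρ a (cross x y) := by
  refine eq_of_bil_eq (isUnit_iff_ne_zero.2 two_ne_zero) fun z => ?_
  have hz : z = ρ a (ρ a⁻¹ z) := by rw [← hρ.mul, mul_inv_cancel, hρ.one]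
  rw [hz, bil_cross, hρ.map_tri, hρ.map_bil, bil_cross, map_mul, map_ofNat]

/-- The matrix of `invol a b`. -/
def involMatrix (a b : Fin 7 → L) : Matrix (Fin 7) (Fin 7) L :=
  Matrix.of fun i => invol a b (e L i)

lemma proj_add (a b x y : Fin 7 → L) : proj a b (x + y) = proj a b x + proj a b y := by
  simp only [proj, bil_add_right]
  module

lemma proj_smul (a b : Fin 7 → L) (r : L) (x : Fin 7 → L) :
    proj a b (r • x) = r • proj a b x := by
  simp only [proj, bil_smul_right]
  module

lemma vecMul_involMatrix (a b x : Fin 7 → L) : x ᵥ* involMatrix a b = invol a b x := by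
  let f : (Fin 7 → L) →ₗ[L] Fin 7 → L :=
    { toFun := invol a b
      map_add' := fun x y => by simp only [invol, proj_add]; module
      map_smul' := fun r x => by simp only [invol, proj_smul, RingHom.id_apply]; module }
  have hx := vecMul_eq_rows x 1
  simp only [vecMul_one, one_row] at hx
  change _ = f x
  conv_rhs => rw [hx]
  simp only [map_add, map_smul]
  exact vecMul_eq_rows x _

lemma IsTwistedAction.movable_invol [CharZero L] (hρ : IsTwistedAction ρ) {a b : Fin 7 → L}
    (hab : bil a b = 0) (ha : bil a a ≠ 0) (hb : bil b b ≠ 0) (haf : ∀ η, ρ η a = a)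
    (hbf : ∀ η, ρ η b = b) (v : Fin 7 → L) : Movable ρ v (invol a b v) := by
  have hmul : involMatrix a b * involMatrix a b = 1 := by
    refine Matrix.ext_of_single_vecMul fun i => ?_
    rw [← vecMul_vecMul, vecMul_involMatrix, vecMul_involMatrix, invol_invol hab ha hb, vecMul_one]
  refine ⟨⟨involMatrix a b, involMatrix a b, hmul, hmul⟩, ⟨fun x y z => ?_, fun x y => ?_⟩,
    vecMul_involMatrix a b v, fun η x => ?_⟩
  · simp only [vecMul_involMatrix]
    rw [tri_invol hab ha hb, one_pow, one_mul]
  · simp only [vecMul_involMatrix]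
    rw [bil_invol hab ha hb, one_pow, one_mul]
  · simp only [vecMul_involMatrix]
    have hpf : ρ η (cross a b) = cross a b := by rw [← hρ.map_cross, haf, hbf]
    -- The projection is built from fixed vectors only, so its coefficients transform semilinearly
    -- and `invol` commutes with `ρ`.
    have h1 (p : Fin 7 → L) (hp : ρ η p = p) : bil p (ρ η x) = η (bil p x) := by
      conv_lhs => rw [← hp, hρ.map_bil]
    have h2 (p : Fin 7 → L) (hp : ρ η p = p) :
        η (bil p p) = bil p p := by
      rw [← hρ.map_bil, hp]
    simp only [invol, proj, hρ.add, hρ.smul, map_div₀, map_neg, map_one, map_ofNat, haf, hbf, hpf,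
      h1 _ (haf η), h1 _ (hbf η), h1 _ hpf, h2 _ (haf η), h2 _ (hbf η), h2 _ hpf]

/-- It suffices to find a rational quaternion subalgebra orthogonal to `v`: its involution negates
`v`. -/
lemma IsTwistedAction.movable_neg [Normal k L] [CharZero L] (hρ : IsTwistedAction ρ)
    {v : Fin 7 → L} (hv : ∀ a, ρ a v = v) : Movable ρ v (-v) := by
  -- Only orthogonality to `v` is wanted here; the repetitions are padding.
  obtain ⟨a, ha, haf, ha0⟩ := hρ.exists_fixed_perp ![v, v, v] (fun i η => by
    fin_cases i <;> exact hv η)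
  obtain ⟨b, hb, hbf, hb0⟩ := hρ.exists_fixed_perp ![v, a, cross v a] (fun i η => by
    fin_cases i
    · exact hv η
    · exact haf η
    · change ρ η (cross v a) = cross v a
      rw [← hρ.map_cross, hv, haf])
  have h1 : bil v a = 0 := ha 0
  have h2 : bil v b = 0 := hb 0
  have h3 : bil a b = 0 := hb 1
  have h4 : bil (cross v a) b = 0 := hb 2
  have hperp : IsPerp a b v := by
    refine ⟨by rwa [bil_comm], by rwa [bil_comm], ?_⟩
    rwa [bil_cross, ← tri_rotate, ← bil_cross]
  have h5 := invol_add (p := 0) v (by simpa using proj_smul a b 0 0) hperp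
  have h := hρ.movable_invol h3 ha0 hb0 haf hbf v
  rw [zero_add] at h5
  rw [h5] at h
  simpa using h

/-- Equal norms make `u + v` and `u - v` orthogonal. An involution fixing the former and negating
the latter exchanges `u` and `v`. -/
lemma IsTwistedAction.movable_of_add [Normal k L] [CharZero L] (hρ : IsTwistedAction ρ)
    {u v : Fin 7 → L} (hu : ∀ a, ρ a u = u) (hv : ∀ a, ρ a v = v)
    (huv : bil u u = bil v v)
    (h0 : bil (u + v) (u + v) ≠ 0) : Movable ρ u v := by
  have hcf (η : L ≃ₐ[k] L) : ρ η (u + (-1 : L) • v) = u + (-1 : L) • v := by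
    rw [hρ.add, hρ.smul, hu, hv, map_neg, map_one]
  have haf (η : L ≃ₐ[k] L) : ρ η (u + v) = u + v := by rw [hρ.add, hu, hv]
  obtain ⟨a, ha⟩ : ∃ a, a = u + v := ⟨_, rfl⟩
  obtain ⟨c, hc⟩ : ∃ c, c = u + (-1 : L) • v := ⟨_, rfl⟩
  have hac : bil a c = 0 := by
    rw [ha, hc]
    simp only [bil_add_left, bil_add_right, bil_smul_right, huv, bil_comm v u]
    ring
  rw [← ha] at h0 haf
  rw [← hc] at hcf
  obtain ⟨b, hb, hbf, hb0⟩ := hρ.exists_fixed_perp ![a, c, cross c a] (fun i η => by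
    fin_cases i
    · exact haf η
    · exact hcf η
    · change ρ η (cross c a) = cross c a
      rw [← hρ.map_cross, hcf, haf])
  have h1 : bil a b = 0 := hb 0
  have h2 : bil c b = 0 := hb 1
  have h3 : bil (cross c a) b = 0 := hb 2
  have hperp : IsPerp a b ((2 : L)⁻¹ • c) := by
    refine ⟨?_, ?_, ?_⟩
    · rw [bil_smul_right, hac, mul_zero]
    · rw [bil_smul_right, bil_comm, h2, mul_zero]
    · rw [bil_smul_right, bil_cross, ← tri_rotate, ← bil_cross, h3, mul_zero]
  have h5 := invol_add (p := (2 : L)⁻¹ • a) _ (by rw [proj_smul, proj_left h1 h0]) hperp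
  have e1 : (2 : L)⁻¹ • a + (2 : L)⁻¹ • c = u := by
    rw [ha, hc]; module
  have e2 : (2 : L)⁻¹ • a + (-1 : L) • (2 : L)⁻¹ • c = v := by
    rw [ha, hc]; module
  have h := hρ.movable_invol h1 h0 hb0 haf hbf u
  rwa [← e1, h5, e1, e2] at h

/-- Fixed vectors of the same non-zero norm are conjugate. -/
lemma IsTwistedAction.movable [Normal k L] [CharZero L] (hρ : IsTwistedAction ρ)
    {u v : Fin 7 → L} (hu : ∀ a, ρ a u = u) (hv : ∀ a, ρ a v = v)
    (huv : bil u u = bil v v) (h0 : bil u u ≠ 0) : Movable ρ u v := by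
  -- The norms of `u + v` and `u - v` add up to `4 bil u u ≠ 0`. If `u + v` is null, the move goes
  -- from `u` to `-v` and then to `v`.
  by_cases h : bil (u + v) (u + v) = 0
  · have hneg (η : L ≃ₐ[k] L) : ρ η (-v) = -v := by
      rw [← neg_one_smul L v, hρ.smul, hv, map_neg, map_one]
    have hn : -v = (-1 : L) • v := (neg_one_smul L v).symm
    have h1 : Movable ρ u (-v) := by
      refine hρ.movable_of_add hu hneg ?_ ?_
      · rw [hn, bil_smul_left, bil_smul_right, huv]; ring
      · intro h2
        rw [hn] at h2
        simp only [bil_add_left, bil_add_right, bil_smul_left, bil_smul_right, ← huv,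
          bil_comm v u] at h h2
        have : (4 : L) * bil u u = 0 := by linear_combination h + h2
        simp [h0] at this
    have h2 := hρ.movable_neg hneg
    rw [neg_neg] at h2
    exact h1.trans h2
  · exact hρ.movable_of_add hu hv huv h

end Descent

/-! ### Twisting by a cocycle and the injectivity -/

section Twist

open Matrix

/-- A scalar is determined by its square and its cube; this is what makes the factor Galois
invariant below. -/
lemma IsSimilitude.unique {F : Type*} [Field F] [CharZero F] {s t : F}
    {g : Matrix (Fin 7) (Fin 7) F} (hs : IsSimilitude s g) (ht : IsSimilitude t g) (h0 : s ≠ 0) :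
    s = t := by
  have h1 := (hs.1 (e F 1) (e F 2) (e F 3)).symm.trans (ht.1 (e F 1) (e F 2) (e F 3))
  have h2 := (hs.2 (e F 0) (e F 0)).symm.trans (ht.2 (e F 0) (e F 0))
  have h3 : tri (e F 1) (e F 2) (e F 3) = 1 := by simp [tri, e]
  have h4 : bil (e F 0) (e F 0) = 2 := by simp [bil, e]
  rw [h3] at h1
  rw [h4] at h2
  have h5 : s ^ 2 = t ^ 2 := mul_right_cancel₀ two_ne_zero h2
  refine mul_left_cancel₀ (pow_ne_zero 2 h0) ?_
  linear_combination h1 - t * h5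

/-- The scalar matrices as elements of `G`. -/
lemma exists_scalar {F : Type*} [Field F] {s : F} (hs : s ≠ 0) :
    ∃ Z : G F, Z.1.1 = Matrix.scalar (Fin 7) s ∧ IsSimilitude s Z.1.1 := by
  have hx (x : Fin 7 → F) : x ᵥ* Matrix.scalar (Fin 7) s = s • x := by
    ext i
    simp [Matrix.scalar_apply, vecMul_diagonal, mul_comm]
  have h : IsSimilitude s (Matrix.scalar (Fin 7) s) := by
    constructor
    · intro x y z
      simp only [hx, tri_smul_left, tri_smul_mid, tri_smul_right]; ring
    · intro x y
      simp only [hx, bil_smul_left, bil_smul_right]; ring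
  have h1 : Matrix.scalar (Fin 7) s * Matrix.scalar (Fin 7) s⁻¹ = 1 := by
    rw [← map_mul, mul_inv_cancel₀ hs, map_one]
  let Z : GL (Fin 7) F := ⟨_, _, h1, mul_eq_one_comm.1 h1⟩
  exact ⟨⟨Z, IsSimilitude.mem_G (g := Z) h⟩, rfl, h⟩

variable {k L : Type*} [Field k] [Field L] [Algebra k L]

/-- The semilinear action on row vectors twisted by a cocycle in `G`. -/
noncomputable def twist (I : (L ≃ₐ[k] L) → G L) (a : L ≃ₐ[k] L) (x : Fin 7 → L) : Fin 7 → L :=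
  (a ∘ x) ᵥ* ((I a)⁻¹).1.1

lemma comp_vecMul (a : L ≃ₐ[k] L) (x : Fin 7 → L) (g : G L) :
    a ∘ (x ᵥ* g.1.1) = (a ∘ x) ᵥ* (a • g).1.1 :=
  (vecMul_map (a : L →+* L) x g.1.1).symm

lemma isTwistedAction_twist [Algebra.IsAlgebraic k L] {I : (L ≃ₐ[k] L) → G L}
    (hI : NonabelianH1.IsCocycle I) (hs : ∀ a, IsSimilitude 1 (I a).1.1) :
    IsTwistedAction (twist I) := by
  have h1 : I 1 = 1 := by
    have h := hI.2 1 1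
    rw [one_mul, one_smul] at h
    exact left_eq_mul.1 h
  have hs' (a : L ≃ₐ[k] L) : IsSimilitude 1 ((I a)⁻¹).1.1 :=
    (hs a).inv (mul_one 1) (coe_inv_mul_G _)
  refine ⟨fun x => ?_, fun a b x => ?_, fun a x y => ?_, fun a r x => ?_, fun x => ?_,
    fun a x y z => ?_, fun a x y => ?_⟩
  · rw [twist, h1, inv_one]
    exact vecMul_one x
  · rw [twist, twist, twist, hI.2, _root_.mul_inv_rev, ← smul_inv', comp_vecMul, vecMul_vecMul,
      coe_mul_G]
    rfl
  · rw [twist, twist, twist, ← add_vecMul]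
    congr 1
    ext i
    simp
  · rw [twist, twist, ← smul_vecMul]
    congr 1
    ext i
    simp
  · have hopen : {a | I a = I 1} ∈ nhds (1 : L ≃ₐ[k] L) :=
      (hI.1.isOpen_fiber (I 1)).mem_nhds rfl
    obtain ⟨E, hE, hEs⟩ := (krullTopology_mem_nhds_one_iff k L _).1 hopen
    have hfin : FiniteDimensional k (IntermediateField.adjoin k (Set.range x)) :=
      IntermediateField.finiteDimensional_adjoin fun y _ =>
        (Algebra.IsAlgebraic.isAlgebraic y).isIntegral
    refine ⟨E ⊔ IntermediateField.adjoin k (Set.range x), inferInstance, fun a ha => ?_⟩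
    rw [IntermediateField.mem_fixingSubgroup_iff] at ha
    have hIa : I a = 1 := by
      rw [← h1]
      refine hEs ?_
      rw [SetLike.mem_coe, IntermediateField.mem_fixingSubgroup_iff]
      exact fun y hy => ha y ((le_sup_left : E ≤ _) hy)
    have hax : a ∘ x = x := by
      ext i
      exact ha (x i) ((le_sup_right : IntermediateField.adjoin k (Set.range x) ≤ _)
        (IntermediateField.subset_adjoin k _ ⟨i, rfl⟩))
    rw [twist, hIa, hax, inv_one]
    exact vecMul_one x
  · rw [twist, twist, twist, (hs' a).1, one_pow, one_mul]
    exact tri_map (a : L →+* L) x y z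
  · rw [twist, twist, (hs' a).2, one_pow, one_mul]
    exact bil_map (a : L →+* L) x y

/-- Commuting with the twisted action means being a rational point of the group twisted by `I`. -/
lemma smul_eq_of_twist {I : (L ≃ₐ[k] L) → G L} {S : G L}
    (h : ∀ a x, twist I a (x ᵥ* S.1.1) = twist I a x ᵥ* S.1.1) (a : L ≃ₐ[k] L) :
    I a * a • S = S * I a := by
  have h1 : (a • S) * (I a)⁻¹ = (I a)⁻¹ * S := by
    refine Subtype.ext (Units.ext (Matrix.ext_of_single_vecMul fun i => ?_))
    have h2 := h a (e L i)
    have h3 : a ∘ e L i = Pi.single i 1 := e_map (a : L →+* L) i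
    rw [twist, twist, comp_vecMul, h3, vecMul_vecMul, vecMul_vecMul] at h2
    exact h2
  rw [eq_inv_mul_iff_mul_eq, ← mul_assoc, mul_inv_eq_iff_eq_mul] at h1
  exact h1

end Twist

/-! ### Rational equivalences and injectivity on cohomology -/

section Main

open Matrix

variable {k K : Type*} [Field k] [CharZero k] [Field K] [Algebra k K]
  (hK : Module.finrank k K = 2) {α : K} (hα : α ∉ Set.range (algebraMap k K))
  (hα2 : α ^ 2 ∈ Set.range (algebraMap k K)) {σ : K ≃ₐ[k] K} (hσ : σ ≠ 1)
  {L : Type*} [Field L] [Algebra k L]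

/-- An equivalence in `G` between two cocycles in `SU_α(2,1)` can be chosen to be an isometry. -/
lemma exists_isometry_equiv [CharZero L] {h i : (L ≃ₐ[k] L) → SU σ L} {g : G L}
    (hg : ∀ η, emb hK hα hα2 hσ L (h η) = g⁻¹ * emb hK hα hα2 hσ L (i η) * η • g) :
    ∃ g' : G L, IsSimilitude 1 g'.1.1 ∧
      ∀ η, g' * emb hK hα hα2 hσ L (h η) = emb hK hα hα2 hσ L (i η) * η • g' := by
  have hg' (η : L ≃ₐ[k] L) :
      g * emb hK hα hα2 hσ L (h η) = emb hK hα hα2 hσ L (i η) * η • g := by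
    rw [hg]; group
  obtain ⟨c, hc⟩ := g.2
  obtain ⟨t, ht0, htc, htb⟩ := exists_similitude g.1.isUnit ((act3_iff_tri _ _).1 hc)
  have hsim : IsSimilitude t g.1.1 := ⟨htc ▸ (act3_iff_tri _ _).1 hc, htb⟩
  -- The two sides of `hg'` are the same matrix, with factors `t` and `η t`, because the cocycles
  -- take values in isometries.
  have hfix (η : L ≃ₐ[k] L) : η t = t := by
    have h1 := hsim.mul (isSimilitude_emb hK hα hα2 hσ L (h η))
    have h2 := (isSimilitude_emb hK hα hα2 hσ L (i η)).mul (hsim.map (η : L →+* L))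
    have h3 : g.1.1 * (emb hK hα hα2 hσ L (h η)).1.1 =
        (emb hK hα hα2 hσ L (i η)).1.1 * g.1.1.map (η : L →+* L) :=
      congrArg (fun g : G L => g.1.1) (hg' η)
    rw [mul_one] at h1
    rw [one_mul, ← h3] at h2
    exact (h1.unique h2 ht0).symm
  obtain ⟨Z, hZ, hZs⟩ := exists_scalar (inv_ne_zero ht0)
  have hZc (X : G L) : Z * X = X * Z := by
    refine Subtype.ext (Units.ext ?_)
    rw [coe_mul_G, coe_mul_G, hZ]
    exact Matrix.scalar_commute _ (fun _ => Commute.all _ _) _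
  have hZη (η : L ≃ₐ[k] L) : η • Z = Z := by
    refine Subtype.ext (Units.ext ?_)
    change Z.1.1.map η = Z.1.1
    rw [hZ]
    ext a b
    by_cases hab : a = b <;> simp [Matrix.scalar_apply, hab, hfix]
  refine ⟨Z * g, ?_, fun η => ?_⟩
  · have := hZs.mul hsim
    rwa [inv_mul_cancel₀ ht0] at this
  · rw [mul_assoc, hg', smul_mul', hZη, ← mul_assoc, hZc, mul_assoc]

theorem H1_map_emb_injective [CharZero L] [Normal k L] :
    Function.Injective (NonabelianH1.H1.map (emb hK hα hα2 hσ L) (emb_smul hK hα hα2 hσ L)) := by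
  intro x y
  refine Quotient.inductionOn₂ x y fun h i hxy => Quotient.sound ?_
  obtain ⟨g₀, hg₀⟩ := Quotient.exact hxy
  obtain ⟨g, hgs, hg⟩ := exists_isometry_equiv hK hα hα2 hσ hg₀
  have hα0 := ne_zero_of_notMem hα
  obtain ⟨a, ha⟩ : ∃ a : k, algebraMap k K a * α ^ 2 = 1 :=
    hα2.imp' (·⁻¹) fun b hb => by rw [map_inv₀, hb, inv_mul_cancel₀ (pow_ne_zero 2 hα0)]
  obtain ⟨v, hv⟩ : ∃ v, v = algebraMap k L ∘ fixedRow a := ⟨_, rfl⟩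
  have hvE (A : SU σ L) : v ᵥ* (emb hK hα hα2 hσ L A).1.1 = v := by
    rw [hv, fixedRow_vecMul_emb hK hα hα2 hσ L ha]
  have hvEi (A : SU σ L) : v ᵥ* ((emb hK hα hα2 hσ L A)⁻¹).1.1 = v := by
    conv_lhs => rw [← hvE A, vecMul_vecMul, coe_mul_inv_G, vecMul_one]
  have hvη (η : L ≃ₐ[k] L) : η ∘ v = v := by
    ext j
    simp [hv]
  have hρ := isTwistedAction_twist (I := fun η => emb hK hα hα2 hσ L (i.1 η))
    ⟨i.2.1.comp _, fun a b => by simp only [i.2.2, map_mul, emb_smul]⟩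
    fun η => isSimilitude_emb hK hα hα2 hσ L (i.1 η)
  have hvf (η : L ≃ₐ[k] L) : twist (fun η => emb hK hα hα2 hσ L (i.1 η)) η v = v := by
    rw [twist, hvη, hvEi]
  -- Here `i_η g^η = g h_η` and `h_η` fixes `v`, so `v g⁻¹` is rational for the action twisted by
  -- `i`.
  have huf (η : L ≃ₐ[k] L) : twist (fun η => emb hK hα hα2 hσ L (i.1 η)) η
      (v ᵥ* (g⁻¹).1.1) = v ᵥ* (g⁻¹).1.1 := by
    rw [twist, comp_vecMul, hvη, vecMul_vecMul, ← coe_mul_G, smul_inv', ← _root_.mul_inv_rev, ← hg,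
      _root_.mul_inv_rev, coe_mul_G, ← vecMul_vecMul, hvEi]
  have hvv : bil v v ≠ 0 := by
    have ha0 : a ≠ 0 := by
      rintro rfl
      simp at ha
    have h1 : bil v v = algebraMap k L (bil (fixedRow a) (fixedRow a)) := by
      rw [hv]; exact bil_map (algebraMap k L) _ _
    have h2 : bil (fixedRow a) (fixedRow a) = 2 * a := by
      simp [bil, fixedRow]; ring
    rw [h1, h2]
    simp [ha0]
  obtain ⟨S, hS, hvS, hSc⟩ := hρ.movable hvf huf
    (by rw [(hgs.inv (mul_one 1) (coe_inv_mul_G g)).2, one_pow, one_mul]) hvv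
  obtain ⟨T, hT⟩ : ∃ T : G L, T.1 = S := ⟨⟨S, hS.mem_G⟩, rfl⟩
  rw [← hT] at hS hvS
  simp only [← hT] at hSc
  -- `T` is a rational point of the group twisted by `i`, so `T g` is still an equivalence between
  -- the two cocycles, and it now fixes `v`.
  obtain ⟨A, hA⟩ := exists_emb_eq hK hα hα2 hσ L ha (X := T * g)
    (by simpa using hS.mul hgs)
    (by rw [← hv, coe_mul_G, ← vecMul_vecMul, hvS, vecMul_vecMul, coe_inv_mul_G, vecMul_one])
  refine ⟨A, fun η => emb_injective hK hα hα2 hσ L ?_⟩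
  rw [map_mul, map_mul, map_inv, emb_smul, hA, mul_assoc, smul_mul', ← mul_assoc _ (η • T),
    smul_eq_of_twist hSc η, mul_assoc, ← hg, ← mul_assoc T, inv_mul_cancel_left]

end Main

end G2Prehom
/-- Let `k` be a field of characteristic zero and `K = k(α)` a quadratic extension with `α ∉ k`,
`α² ∈ k`, and let `σ` be the non-trivial element of `Gal(K/k)`. Then the natural map
`H¹(k, SU_α(2,1)) → H¹(k, G)` is injective. -/
theorem mainTheorem7 {k K : Type*} [Field k] [CharZero k] [Field K] [Algebra k K]
    (hK : Module.finrank k K = 2) {α : K} (hα : α ∉ Set.range (algebraMap k K))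
    (hα2 : α ^ 2 ∈ Set.range (algebraMap k K)) {σ : K ≃ₐ[k] K} (hσ : σ ≠ 1) :
    Function.Injective (G2Prehom.H1SUtoG hK hα hα2 hσ) := by
  have : CharZero (AlgebraicClosure k) := AlgebraicClosure.instCharZero k
  exact G2Prehom.H1_map_emb_injective hK hα hα2 hσ
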